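/- Let $0<p<\infty$, let $\mathbb F\in\{\mathbb R,\mathbb C\}$, and let $w=(w_j)_{j\ge1}$ be a non-increasing sequence of positive real numbers with $w_1=1$, $\lim_j w_j=0$ and $\sum_j w_j=\infty$. Let $g(w,p)$ be the Garling sequence space, i.e. the quasi-Banach space of all $x=(a_j)_{j\ge1}\in\mathbb F^{\mathbb N}$ such that \[ \|x\|_g=\sup_{\phi}\Bigl(\sum_{j=1}^\infty |a_{\phi(j)}|^p\,w_j\Bigr)^{1/p}<\infty , \] where the supremum is taken over all (strictly) increasing maps $\phi\colon\mathbb N\to\mathbb N$. A sequence is *basic* if it is a Schauder basis of its closed linear span. Two basic sequences $(x_n)$, $(y_n)$ (in possibly different spaces) are *equivalent* if, for all scalars $(a_n)$, the series $\sum_n a_nx_n$ converges if and only if $\sum_n a_ny_n$ does. A basic sequence $(y_n)$ is *subsymmetric* if it is unconditional, i.e. $(y_{\pi(n)})$ is a basic sequence for every permutation $\pi$ of $\mathbb N$, and $(y_{\phi(n)})$ is equivalent to $(y_n)$ for every increasing $\phi\colon\mathbb N\to\mathbb N$. Theorem. Let $\mathcal B=(y_k)_{k\ge1}$ be a subsymmetric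 basic sequence in $g(w,p)$ that is not equivalent to the unit vector system of $\ell_p$. Then $\ell_\infty$ is block finitely representable on $\mathcal B$; that is, for every $n\in\mathbb N$ and every $\varepsilon>0$ there are non-zero finite linear combinations $z_i=\sum_{k\in A_i}c_k y_k$, $i=1,\dots,n$, over finite sets of indices with $\max A_i<\min A_{i+1}$ for $1\le i<n$, such that \[ \max_{1\le i\le n}|a_i|\le\Bigl\|\sum_{i=1}^n a_i z_i\Bigr\|_g\le(1+\varepsilon)\max_{1\le i\le n}|a_i| \qquad\text{for all } a_1,\dots,a_n\in\mathbb F . \] -/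

import Mathlib

open Filter Topology
open scoped ENNReal

/-! ### Sequences in a vector space with a quasi-norm

The quasi-norm of a space is supplied by a `Norm` instance only, since the spaces considered need
not be locally convex. -/

section Sequences

variable (𝕜 : Type*) [RCLike 𝕜] {X : Type*} [AddCommGroup X] [Module 𝕜 X] [Norm X]
  {Y : Type*} [AddCommGroup Y] [Module 𝕜 Y] [Norm Y]

/-- `x = ∑ₙ aₙ yₙ`: the partial sums of the series converge to `x` in the quasi-norm. -/
def SeriesConvergesTo (y : ℕ → X) (a : ℕ → 𝕜) (x : X) : Prop :=
  Tendsto (fun n : ℕ => ‖x - ∑ i ∈ Finset.range n, a i • y i‖) atTop (𝓝 0)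

/-- The closed linear span of a sequence, the closure being taken in the quasi-norm. -/
def closedSpan (y : ℕ → X) : Set X :=
  {x | ∀ ε : ℝ, 0 < ε → ∃ z ∈ Submodule.span 𝕜 (Set.range y), ‖x - z‖ < ε}

/-- A basic sequence: a Schauder basis of its closed linear span. -/
def IsBasicSequence (y : ℕ → X) : Prop :=
  ∀ x ∈ closedSpan 𝕜 y, ∃! a : ℕ → 𝕜, SeriesConvergesTo 𝕜 y a x

/-- Two sequences are equivalent if for all scalars `(aₙ)` the series `∑ aₙ xₙ` converges
exactly when the series `∑ aₙ yₙ` does. -/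
def EquivalentSequences (x : ℕ → X) (y : ℕ → Y) : Prop :=
  ∀ a : ℕ → 𝕜, (∃ s, SeriesConvergesTo 𝕜 x a s) ↔ (∃ t, SeriesConvergesTo 𝕜 y a t)

/-- A subsymmetric basic sequence: a basic sequence which is unconditional (every rearrangement
is a basic sequence) and equivalent to each of its subsequences. -/
structure IsSubsymmetricBasicSequence (y : ℕ → X) : Prop where
  basic : IsBasicSequence 𝕜 y
  unconditional : ∀ π : Equiv.Perm ℕ, IsBasicSequence 𝕜 (fun n => y (π n))
  spreading : ∀ φ : ℕ → ℕ, StrictMono φ → EquivalentSequences 𝕜 (fun n => y (φ n)) y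

/-- `z₁ ≺ ⋯ ≺ zₙ` is a finite block sequence of `y`: non-zero finite linear combinations of
the terms of `y` over successive sets of indices. -/
def IsFiniteBlockSequence (y : ℕ → X) {n : ℕ} (z : Fin n → X) : Prop :=
  ∃ c : Fin n → (ℕ →₀ 𝕜),
    (∀ i, z i = Finsupp.linearCombination 𝕜 y (c i)) ∧
    (∀ i, z i ≠ 0) ∧
    (∀ i j, i < j → ∀ k ∈ (c i).support, ∀ l ∈ (c j).support, k < l)

/-- `ℓ_∞` is block finitely representable on `y`: for all `n` and `ε > 0` there is a block
sequence of `y` of length `n` which is `(1 + ε)`-equivalent to the unit vector basis of `ℓ_∞ⁿ`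
(the type `Fin n → 𝕜` carries the supremum norm). -/
def LInftyBlockFinitelyRepresentable (y : ℕ → X) : Prop :=
  ∀ (n : ℕ) (ε : ℝ), 0 < ε → ∃ z : Fin n → X, IsFiniteBlockSequence 𝕜 y z ∧
    ∀ a : Fin n → 𝕜, ‖a‖ ≤ ‖∑ i, a i • z i‖ ∧ ‖∑ i, a i • z i‖ ≤ (1 + ε) * ‖a‖

end Sequences

/-! ### Garling sequence spaces -/

/-- The set of weights `𝒲`; sequences are indexed from `0`. -/
structure IsGarlingWeight (w : ℕ → ℝ) : Prop where
  normalized : w 0 = 1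
  antitone : Antitone w
  pos : ∀ n, 0 < w n
  tendsto_zero : Tendsto w atTop (𝓝 0)
  not_summable : ¬ Summable w

section Garling

variable {𝕜 : Type*} [RCLike 𝕜]

/-- `sup_φ (∑ⱼ |a_{φ(j)}|^p wⱼ)^{1/p}` over all increasing `φ : ℕ → ℕ`, with values in `[0, ∞]`. -/
noncomputable def garlingENorm (w : ℕ → ℝ) (p : ℝ) (x : ℕ → 𝕜) : ℝ≥0∞ :=
  ⨆ (φ : ℕ → ℕ) (_ : StrictMono φ),
    (∑' j, ‖x (φ j)‖ₑ ^ p * ENNReal.ofReal (w j)) ^ (1 / p)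

theorem garlingENorm_zero (w : ℕ → ℝ) {p : ℝ} (hp : 0 < p) :
    garlingENorm w p (0 : ℕ → 𝕜) = 0 := by
  simp [garlingENorm, hp]

theorem garlingENorm_smul_le (w : ℕ → ℝ) {p : ℝ} (hp : 0 < p) (c : 𝕜) (x : ℕ → 𝕜) :
    garlingENorm w p (c • x) ≤ ‖c‖ₑ * garlingENorm w p x := by
  refine iSup₂_le fun φ hφ => ?_
  have h : (∑' j, ‖(c • x) (φ j)‖ₑ ^ p * ENNReal.ofReal (w j))
      = ‖c‖ₑ ^ p * ∑' j, ‖x (φ j)‖ₑ ^ p * ENNReal.ofReal (w j) := by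
    rw [← ENNReal.tsum_mul_left]
    refine tsum_congr fun j => ?_
    rw [Pi.smul_apply, smul_eq_mul, enorm_mul, ENNReal.mul_rpow_of_nonneg _ _ hp.le, mul_assoc]
  rw [h, ENNReal.mul_rpow_of_nonneg _ _ (by positivity), one_div,
    ENNReal.rpow_rpow_inv hp.ne', ← one_div]
  gcongr
  exact le_iSup₂ (f := fun (φ : ℕ → ℕ) (_ : StrictMono φ) =>
    (∑' j, ‖x (φ j)‖ₑ ^ p * ENNReal.ofReal (w j)) ^ (1 / p)) φ hφ

theorem garlingENorm_add_lt_top (w : ℕ → ℝ) {p : ℝ} (hp : 0 < p) {x y : ℕ → 𝕜}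
    (hx : garlingENorm w p x < ∞) (hy : garlingENorm w p y < ∞) :
    garlingENorm w p (x + y) < ∞ := by
  have key : garlingENorm w p (x + y) ≤
      ((2 : ℝ≥0∞) ^ p * (garlingENorm w p x ^ p + garlingENorm w p y ^ p)) ^ (1 / p) := by
    refine iSup₂_le fun φ hφ => ?_
    refine ENNReal.rpow_le_rpow ?_ (by positivity)
    have hb : ∀ u : ℕ → 𝕜, (∑' j, ‖u (φ j)‖ₑ ^ p * ENNReal.ofReal (w j))
        ≤ garlingENorm w p u ^ p := by
      intro u
      have h : (∑' j, ‖u (φ j)‖ₑ ^ p * ENNReal.ofReal (w j)) ^ (1 / p) ≤ garlingENorm w p u :=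
        le_iSup₂ (f := fun (φ : ℕ → ℕ) (_ : StrictMono φ) =>
          (∑' j, ‖u (φ j)‖ₑ ^ p * ENNReal.ofReal (w j)) ^ (1 / p)) φ hφ
      rw [one_div] at h
      exact (ENNReal.rpow_inv_le_iff hp).1 h
    calc (∑' j, ‖(x + y) (φ j)‖ₑ ^ p * ENNReal.ofReal (w j))
        ≤ ∑' j, 2 ^ p * (‖x (φ j)‖ₑ ^ p * ENNReal.ofReal (w j)
            + ‖y (φ j)‖ₑ ^ p * ENNReal.ofReal (w j)) := by
          refine ENNReal.tsum_le_tsum fun j => ?_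
          rw [← add_mul, ← mul_assoc]
          gcongr
          set s := ‖x (φ j)‖ₑ
          set t := ‖y (φ j)‖ₑ
          have h1 : ‖(x + y) (φ j)‖ₑ ≤ 2 * max s t := by
            refine (enorm_add_le _ _).trans ?_
            rw [two_mul]
            exact add_le_add (le_max_left _ _) (le_max_right _ _)
          calc ‖(x + y) (φ j)‖ₑ ^ p ≤ (2 * max s t) ^ p := ENNReal.rpow_le_rpow h1 hp.le
            _ = 2 ^ p * (max s t) ^ p := ENNReal.mul_rpow_of_nonneg _ _ hp.le
            _ ≤ 2 ^ p * (s ^ p + t ^ p) := by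
              gcongr
              rcases le_total s t with h | h
              · rw [max_eq_right h]; exact le_add_self
              · rw [max_eq_left h]; exact le_self_add
      _ = 2 ^ p * ((∑' j, ‖x (φ j)‖ₑ ^ p * ENNReal.ofReal (w j))
            + ∑' j, ‖y (φ j)‖ₑ ^ p * ENNReal.ofReal (w j)) := by
          rw [ENNReal.tsum_mul_left, ENNReal.tsum_add]
      _ ≤ _ := by
          gcongr
          · exact hb x
          · exact hb y
  refine key.trans_lt (ENNReal.rpow_lt_top_of_nonneg (by positivity) ?_)
  exact ENNReal.mul_ne_top (ENNReal.rpow_ne_top_of_nonneg hp.le (by simp))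
    (ENNReal.add_ne_top.2 ⟨ENNReal.rpow_ne_top_of_nonneg hp.le hx.ne,
      ENNReal.rpow_ne_top_of_nonneg hp.le hy.ne⟩)

variable (𝕜) in
/-- The Garling sequence space `g(w, p)`. -/
def garlingSpace (w : ℕ → ℝ) (p : ℝ) (hp : 0 < p) : Submodule 𝕜 (ℕ → 𝕜) where
  carrier := {x | garlingENorm w p x < ∞}
  zero_mem' := by
    show garlingENorm w p (0 : ℕ → 𝕜) < ∞
    rw [garlingENorm_zero w hp]
    exact ENNReal.zero_lt_top
  add_mem' := fun hx hy => garlingENorm_add_lt_top w hp hx hy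
  smul_mem' := fun c x hx =>
    (garlingENorm_smul_le w hp c x).trans_lt (ENNReal.mul_lt_top (by simp) hx)

/-- The Garling quasi-norm on `g(w, p)`. -/
noncomputable instance garlingNorm (w : ℕ → ℝ) (p : ℝ) (hp : 0 < p) :
    Norm (garlingSpace 𝕜 w p hp) where
  norm x := (garlingENorm w p (x : ℕ → 𝕜)).toReal

variable (𝕜) in
/-- The unit vector system of `ℓ_p`. -/
noncomputable def lpUnitVectors (p : ℝ) : ℕ → lp (fun _ : ℕ => 𝕜) (ENNReal.ofReal p) :=
  fun n => lp.single (ENNReal.ofReal p) n (1 : 𝕜)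

end Garling

/-! Write `modulus x` for the p-th power of the Garling quasi-norm. It is the supremum, over finite
sets `S` of indices, of the sum of the p-th powers of the entries on `S`, weighted in increasing
order by w_0, w_1, .... If `S` is followed by `T`, the part over `T` meets the weights shifted by
the cardinality of `S`. Everything rests on these shifted sums (`shiftedSum`, `shiftedSum_union`).

A subsymmetric basic sequence y is semi-normalized. Along a coordinatewise convergent subsequence,
differences of successive terms tend to zero in each coordinate, and a gliding hump makes them
summable perturbations of blocks x_k of the unit vectors, with moduli between positive constants
(`exists_block_sequence`). There are two cases.

Suppose the shifted sums of the blocks do not vanish uniformly: some c > 0 is exceeded for every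
shift, by blocks arbitrarily far out. Blocks can then be selected that keep a sum above c after all
earlier indices have used up their weights, which gives a lower p-estimate
(`exists_lower_estimate`). The upper p-estimate is automatic for disjoint supports. Subsymmetry
carries both back to y, which is thus equivalent to the unit vectors of ℓ_p
(`equivalentSequences_lpUnitVectors`). This case is excluded.

Otherwise a large shift makes all far blocks small. A block then has a coordinate of definite size,
so a sum of m blocks has modulus at least a multiple of w_0 + ... + w_{m-1}, which is unbounded, and
its normalization is flat when m is large. If a flat u precedes v, a set `S` either spends few
indices on u and gains little there, or spends many and shifts v to where it is small
(`modulus_add_le_of_flat`). Hence the modulus of u + v hardly exceeds the larger of the two.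
Iterating, with lengths chosen from the last vector to the first, gives almost isometric copies of
ℓ_∞^n (`exists_sizes_modulus_sum_le`, `exists_almost_isometric`).

For uniform treatment of all p the space carries the F-norm ‖x‖_g ^ min(1,p), which satisfies the
triangle inequality and is complete, so that Baire's theorem and unconditional summation apply. -/

/-! ### Weighted sums over finite sets and the Garling quasi-norm -/

section WeightedSums

variable {𝕜 : Type*} [RCLike 𝕜] {w : ℕ → ℝ} {p : ℝ}

/-- `∑ₖ |x_{i_k}|^p w_{N + k}`, where `i₀ < i₁ < ⋯` are the elements of `S`. -/
noncomputable def shiftedSum (w : ℕ → ℝ) (p : ℝ) (N : ℕ) (S : Finset ℕ) (x : ℕ → 𝕜) : ℝ :=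
  ∑ i ∈ S, ‖x i‖ ^ p * w (N + (S.filter (· < i)).card)

theorem IsGarlingWeight.le_one (hw : IsGarlingWeight w) (n : ℕ) : w n ≤ 1 :=
  hw.normalized ▸ hw.antitone (Nat.zero_le n)

theorem shiftedSum_nonneg (hw : IsGarlingWeight w) (N : ℕ) (S : Finset ℕ) (x : ℕ → 𝕜) :
    0 ≤ shiftedSum w p N S x :=
  Finset.sum_nonneg fun _ _ => mul_nonneg (Real.rpow_nonneg (norm_nonneg _) _) (hw.pos _).le

theorem shiftedSum_empty (N : ℕ) (x : ℕ → 𝕜) : shiftedSum w p N ∅ x = 0 := by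
  simp [shiftedSum]

theorem shiftedSum_anti (hw : IsGarlingWeight w) {N M : ℕ} (h : N ≤ M) (S : Finset ℕ)
    (x : ℕ → 𝕜) : shiftedSum w p M S x ≤ shiftedSum w p N S x :=
  Finset.sum_le_sum fun _ _ => mul_le_mul_of_nonneg_left (hw.antitone (by lia))
    (Real.rpow_nonneg (norm_nonneg _) _)

theorem shiftedSum_mono (hw : IsGarlingWeight w) (hp : 0 < p) (N : ℕ) {S : Finset ℕ}
    {x y : ℕ → 𝕜} (h : ∀ i ∈ S, ‖x i‖ ≤ ‖y i‖) :
    shiftedSum w p N S x ≤ shiftedSum w p N S y :=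
  Finset.sum_le_sum fun i hi => mul_le_mul_of_nonneg_right
    (Real.rpow_le_rpow (norm_nonneg _) (h i hi) hp.le) (hw.pos _).le

theorem shiftedSum_congr (N : ℕ) {S : Finset ℕ} {x y : ℕ → 𝕜} (h : ∀ i ∈ S, x i = y i) :
    shiftedSum w p N S x = shiftedSum w p N S y :=
  Finset.sum_congr rfl fun i hi => by rw [h i hi]

theorem shiftedSum_smul (N : ℕ) (S : Finset ℕ) (c : 𝕜) (x : ℕ → 𝕜) :
    shiftedSum w p N S (c • x) = ‖c‖ ^ p * shiftedSum w p N S x := by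
  rw [shiftedSum, shiftedSum, Finset.mul_sum]
  refine Finset.sum_congr rfl fun i _ => ?_
  rw [Pi.smul_apply, smul_eq_mul, norm_mul, Real.mul_rpow (norm_nonneg _) (norm_nonneg _),
    mul_assoc]

theorem shiftedSum_le_sum {ι : Type*} (hw : IsGarlingWeight w) (N : ℕ) (S : Finset ℕ)
    (A : Finset ι) (x : ℕ → 𝕜) (u : ι → ℕ → 𝕜)
    (h : ∀ i ∈ S, ‖x i‖ ^ p ≤ ∑ k ∈ A, ‖u k i‖ ^ p) :
    shiftedSum w p N S x ≤ ∑ k ∈ A, shiftedSum w p N S (u k) := by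
  simp only [shiftedSum]
  rw [Finset.sum_comm]
  refine Finset.sum_le_sum fun i hi => ?_
  rw [← Finset.sum_mul]
  exact mul_le_mul_of_nonneg_right (h i hi) (hw.pos _).le

/-- Discarding indices with zero entry moves the remaining entries to earlier, hence larger,
weights. -/
theorem shiftedSum_le_of_subset (hw : IsGarlingWeight w) (hp : 0 < p) (N : ℕ)
    {S T : Finset ℕ} (hTS : T ⊆ S) (x : ℕ → 𝕜) (h : ∀ i ∈ S, i ∉ T → x i = 0) :
    shiftedSum w p N S x ≤ shiftedSum w p N T x := by
  have h1 : shiftedSum w p N S x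
      = ∑ i ∈ T, ‖x i‖ ^ p * w (N + (S.filter (· < i)).card) := by
    refine (Finset.sum_subset hTS fun i hi hiT => ?_).symm
    rw [h i hi hiT, norm_zero, Real.zero_rpow hp.ne', zero_mul]
  rw [h1]
  refine Finset.sum_le_sum fun i _ => mul_le_mul_of_nonneg_left (hw.antitone ?_)
    (Real.rpow_nonneg (norm_nonneg _) _)
  have := Finset.card_le_card (Finset.filter_subset_filter (· < i) hTS)
  lia

/-- The indices in `S` use up the first `S.card` weights, so those in `T` meet the weights after
them. -/
theorem shiftedSum_union (N : ℕ) {S T : Finset ℕ} (hST : ∀ i ∈ S, ∀ j ∈ T, i < j)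
    (x : ℕ → 𝕜) :
    shiftedSum w p N (S ∪ T) x = shiftedSum w p N S x + shiftedSum w p (N + S.card) T x := by
  have hd : Disjoint S T := Finset.disjoint_left.2 fun i hi hj => (hST i hi i hj).false
  rw [shiftedSum, Finset.sum_union hd]
  congr 1
  · refine Finset.sum_congr rfl fun i hi => ?_
    rw [Finset.filter_union, Finset.filter_false_of_mem (s := T)
      fun j hj => (hST i hi j hj).not_gt, Finset.union_empty]
  · refine Finset.sum_congr rfl fun i hi => ?_
    rw [Finset.filter_union, Finset.filter_true_of_mem (s := S) fun j hj => hST j hj i hi,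
      Finset.card_union_of_disjoint (hd.mono_right (Finset.filter_subset _ _)), add_assoc]

theorem sum_card_filter_lt (f : ℕ → ℝ) (S : Finset ℕ) :
    ∑ i ∈ S, f (S.filter (· < i)).card = ∑ j ∈ Finset.range S.card, f j := by
  induction S using Finset.induction_on_max with
  | empty => simp
  | insert a s ha ih =>
    have hn : a ∉ s := fun h => (ha a h).false
    rw [Finset.sum_insert hn, Finset.card_insert_of_notMem hn, Finset.sum_range_succ, ← ih,
      add_comm]
    congr 1
    · refine Finset.sum_congr rfl fun i hi => ?_
      rw [Finset.filter_insert, if_neg (ha i hi).not_gt]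
    · rw [Finset.filter_insert, if_neg (lt_irrefl a), Finset.filter_true_of_mem ha]

/-- A shift costs little when the entries are small: the sum of the differences w_j - w_{N+j}
telescopes to at most w_0 + ... + w_{N-1}, which is at most N. -/
theorem shiftedSum_zero_le_add (hw : IsGarlingWeight w) (N : ℕ) (S : Finset ℕ) (x : ℕ → 𝕜)
    {C : ℝ} (hC : 0 ≤ C) (h : ∀ i ∈ S, ‖x i‖ ^ p ≤ C) :
    shiftedSum w p 0 S x ≤ shiftedSum w p N S x + C * N := by
  have h1 : shiftedSum w p 0 S x - shiftedSum w p N S x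
      ≤ C * ∑ j ∈ Finset.range S.card, (w j - w (N + j)) := by
    rw [← sum_card_filter_lt (fun j => w j - w (N + j)), shiftedSum, shiftedSum,
      ← Finset.sum_sub_distrib, Finset.mul_sum]
    refine Finset.sum_le_sum fun i hi => ?_
    rw [← mul_sub, zero_add]
    exact mul_le_mul_of_nonneg_right (h i hi) (sub_nonneg.2 (hw.antitone (by lia)))
  have h2 : ∑ j ∈ Finset.range S.card, (w j - w (N + j)) ≤ N := by
    have h3 := Finset.sum_range_add w N S.card
    have h4 : ∑ j ∈ Finset.range S.card, w j ≤ ∑ j ∈ Finset.range (N + S.card), w j :=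
      Finset.sum_le_sum_of_subset_of_nonneg (Finset.range_mono (by lia))
        fun _ _ _ => (hw.pos _).le
    have h5 : ∑ j ∈ Finset.range N, w j ≤ N := by
      simpa using Finset.sum_le_card_nsmul (Finset.range N) w 1 fun j _ => hw.le_one j
    rw [Finset.sum_sub_distrib]
    linarith
  have := mul_le_mul_of_nonneg_left h2 hC
  linarith

theorem mul_sum_range_le_shiftedSum (hw : IsGarlingWeight w) (S : Finset ℕ) (x : ℕ → 𝕜)
    {δ : ℝ} (h : ∀ i ∈ S, δ ≤ ‖x i‖ ^ p) :
    δ * ∑ j ∈ Finset.range S.card, w j ≤ shiftedSum w p 0 S x := by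
  rw [← sum_card_filter_lt, shiftedSum, Finset.mul_sum]
  refine Finset.sum_le_sum fun i hi => ?_
  rw [zero_add]
  exact mul_le_mul_of_nonneg_right (h i hi) (hw.pos _).le

theorem shiftedSum_le_card_mul (hw : IsGarlingWeight w) (N : ℕ) (S : Finset ℕ) (x : ℕ → 𝕜)
    {C : ℝ} (h : ∀ i ∈ S, ‖x i‖ ^ p ≤ C) :
    shiftedSum w p N S x ≤ S.card * C := by
  rw [← nsmul_eq_mul]
  refine Finset.sum_le_card_nsmul _ _ _ fun i hi => ?_
  exact (mul_le_of_le_one_right (Real.rpow_nonneg (norm_nonneg _) _) (hw.le_one _)).trans (h i hi)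

theorem shiftedSum_singleton (N i : ℕ) (x : ℕ → 𝕜) :
    shiftedSum w p N {i} x = ‖x i‖ ^ p * w N := by
  simp [shiftedSum, Finset.filter_singleton]

theorem IsGarlingWeight.tendsto_sum (hw : IsGarlingWeight w) :
    Tendsto (fun n => ∑ j ∈ Finset.range n, w j) atTop atTop :=
  (not_summable_iff_tendsto_nat_atTop_of_nonneg fun n => (hw.pos n).le).1 hw.not_summable

theorem shiftedSum_add_le (hw : IsGarlingWeight w) (hp : 0 < p) (hp1 : p ≤ 1) (N : ℕ)
    (S : Finset ℕ) (x y : ℕ → 𝕜) :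
    shiftedSum w p N S (x + y) ≤ shiftedSum w p N S x + shiftedSum w p N S y := by
  simp only [shiftedSum]
  rw [← Finset.sum_add_distrib]
  refine Finset.sum_le_sum fun i _ => ?_
  rw [← add_mul]
  refine mul_le_mul_of_nonneg_right ?_ (hw.pos _).le
  exact (Real.rpow_le_rpow (norm_nonneg _) (norm_add_le _ _) hp.le).trans
    (Real.rpow_add_le_add_rpow (norm_nonneg _) (norm_nonneg _) hp.le hp1)

theorem shiftedSum_rpow_add_le (hw : IsGarlingWeight w) (hp1 : 1 ≤ p) (N : ℕ)
    (S : Finset ℕ) (x y : ℕ → 𝕜) :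
    shiftedSum w p N S (x + y) ^ (1 / p) ≤
      shiftedSum w p N S x ^ (1 / p) + shiftedSum w p N S y ^ (1 / p) := by
  have hp : 0 < p := by linarith
  -- The weight enters the entries as its p-th root, so that Minkowski's inequality applies.
  have key : ∀ u : ℕ → ℝ, (∀ i, 0 ≤ u i) → ∀ i,
      |u i * w (N + (S.filter (· < i)).card) ^ (1 / p)| ^ p
        = u i ^ p * w (N + (S.filter (· < i)).card) := by
    intro u hu i
    have hwi := (hw.pos (N + (S.filter (· < i)).card)).le
    rw [abs_of_nonneg (mul_nonneg (hu i) (Real.rpow_nonneg hwi _)),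
      Real.mul_rpow (hu i) (Real.rpow_nonneg hwi _), ← Real.rpow_mul hwi,
      one_div_mul_cancel hp.ne', Real.rpow_one]
  have h := Real.Lp_add_le S (fun i => ‖x i‖ * w (N + (S.filter (· < i)).card) ^ (1 / p))
    (fun i => ‖y i‖ * w (N + (S.filter (· < i)).card) ^ (1 / p)) hp1
  simp only [← add_mul] at h
  simp only [key (fun i => ‖x i‖) (fun i => norm_nonneg _),
    key (fun i => ‖y i‖) (fun i => norm_nonneg _),
    key (fun i => ‖x i‖ + ‖y i‖) (fun i => add_nonneg (norm_nonneg _) (norm_nonneg _))] at h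
  refine le_trans (Real.rpow_le_rpow (shiftedSum_nonneg hw _ _ _) ?_ (by positivity)) h
  refine Finset.sum_le_sum fun i _ => mul_le_mul_of_nonneg_right ?_ (hw.pos _).le
  exact Real.rpow_le_rpow (norm_nonneg _) (norm_add_le _ _) hp.le

theorem ofReal_shiftedSum (hw : IsGarlingWeight w) (hp : 0 < p) (S : Finset ℕ) (x : ℕ → 𝕜) :
    ENNReal.ofReal (shiftedSum w p 0 S x)
      = ∑ i ∈ S, ‖x i‖ₑ ^ p * ENNReal.ofReal (w (S.filter (· < i)).card) := by
  rw [shiftedSum, ENNReal.ofReal_sum_of_nonneg fun i _ =>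
    mul_nonneg (Real.rpow_nonneg (norm_nonneg _) _) (hw.pos _).le]
  refine Finset.sum_congr rfl fun i _ => ?_
  rw [ENNReal.ofReal_mul (Real.rpow_nonneg (norm_nonneg _) _),
    ← ENNReal.ofReal_rpow_of_nonneg (norm_nonneg _) hp.le, ofReal_norm, zero_add]

/-- Truncating an increasing map gives a finite set. Conversely, a finite set is an initial segment
of the range of an increasing map. -/
theorem garlingENorm_rpow (hw : IsGarlingWeight w) (hp : 0 < p) (x : ℕ → 𝕜) :
    garlingENorm w p x ^ p = ⨆ S : Finset ℕ, ENNReal.ofReal (shiftedSum w p 0 S x) := by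
  apply le_antisymm
  · rw [← ENNReal.le_rpow_inv_iff hp]
    refine iSup₂_le fun φ hφ => ?_
    rw [one_div]
    refine ENNReal.rpow_le_rpow ?_ (by positivity)
    rw [ENNReal.tsum_eq_iSup_nat]
    refine iSup_le fun n => ?_
    refine le_trans (le_of_eq ?_) (le_iSup _ ((Finset.range n).map ⟨φ, hφ.injective⟩))
    rw [ofReal_shiftedSum hw hp, Finset.sum_map]
    refine Finset.sum_congr rfl fun j hj => ?_
    have : ((Finset.range n).map ⟨φ, hφ.injective⟩).filter (· < φ j)
        = (Finset.range j).map ⟨φ, hφ.injective⟩ := by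
      ext k
      simp only [Finset.mem_filter, Finset.mem_map, Finset.mem_range,
        Function.Embedding.coeFn_mk] at hj ⊢
      constructor
      · rintro ⟨⟨a, ha, rfl⟩, hk⟩
        exact ⟨a, hφ.lt_iff_lt.1 hk, rfl⟩
      · rintro ⟨a, ha, rfl⟩
        exact ⟨⟨a, ha.trans hj, rfl⟩, hφ ha⟩
    simp only [Function.Embedding.coeFn_mk]
    rw [this, Finset.card_map, Finset.card_range]
  · refine iSup_le fun S => ?_
    rw [← ENNReal.rpow_inv_le_iff hp, ofReal_shiftedSum hw hp]
    -- The set is completed by all integers beyond its maximum, which leaves the rank of its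
    -- elements unchanged.
    let P : ℕ → Prop := fun i => i ∈ S ∨ ∀ k ∈ S, k < i
    have hP : (Set.ofPred P).Infinite := by
      refine Set.infinite_of_not_bddAbove fun ⟨b, hb⟩ => ?_
      have h1 : P (S.sup id + b + 1) := Or.inr fun k hk => by
        have : k ≤ S.sup id := Finset.le_sup (f := id) hk
        lia
      have := hb h1
      lia
    classical
    refine le_trans ?_ (le_iSup₂ (f := fun (φ : ℕ → ℕ) (_ : StrictMono φ) =>
      (∑' j, ‖x (φ j)‖ₑ ^ p * ENNReal.ofReal (w j)) ^ (1 / p)) (Nat.nth P)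
        (Nat.nth_strictMono hP))
    rw [one_div]
    refine ENNReal.rpow_le_rpow ?_ (by positivity)
    have hcount : ∀ i ∈ S, Nat.count P i = (S.filter (· < i)).card := by
      intro i hi
      rw [Nat.count_eq_card_filter_range]
      congr 1
      ext k
      simp only [Finset.mem_filter, Finset.mem_range, P]
      constructor
      · rintro ⟨h1, h2 | h2⟩
        · exact ⟨h2, h1⟩
        · exact absurd (h2 i hi) h1.not_gt
      · rintro ⟨h1, h2⟩
        exact ⟨h2, Or.inl h1⟩
    have hinj : Set.InjOn (Nat.count P) S := fun i hi j hj h => by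
      rw [← Nat.nth_count (p := P) (n := i) (Or.inl hi), h, Nat.nth_count (p := P) (Or.inl hj)]
    refine le_trans (le_of_eq ?_) (ENNReal.sum_le_tsum (S.image (Nat.count P)))
    rw [Finset.sum_image hinj]
    refine Finset.sum_congr rfl fun i hi => ?_
    rw [Nat.nth_count (p := P) (Or.inl hi), hcount i hi]

end WeightedSums

/-! ### The Garling space with a complete F-norm -/

section GarlingF

variable {𝕜 : Type*} [RCLike 𝕜] {w : ℕ → ℝ} {p : ℝ}

theorem garlingENorm_lt_top_iff (hw : IsGarlingWeight w) (hp : 0 < p) (x : ℕ → 𝕜) :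
    garlingENorm w p x < ∞ ↔ ∃ M, ∀ S, shiftedSum w p 0 S x ≤ M := by
  rw [← ENNReal.rpow_lt_top_iff_of_pos hp, garlingENorm_rpow hw hp]
  constructor
  · intro h
    refine ⟨(⨆ S, ENNReal.ofReal (shiftedSum w p 0 S x)).toReal, fun S => ?_⟩
    rw [← ENNReal.ofReal_le_iff_le_toReal h.ne]
    exact le_iSup (fun S => ENNReal.ofReal (shiftedSum w p 0 S x)) S
  · rintro ⟨M, hM⟩
    exact (iSup_le fun S => ENNReal.ofReal_le_ofReal (hM S)).trans_lt ENNReal.ofReal_lt_top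

variable (𝕜) in
/-- The Garling sequence space with the F-norm `‖x‖_g ^ min 1 p`. -/
def GarlingF (_hw : IsGarlingWeight w) (hp : 0 < p) : Type _ := garlingSpace 𝕜 w p hp

namespace GarlingF

variable {hw : IsGarlingWeight w} {hp : 0 < p}

instance : AddCommGroup (GarlingF 𝕜 hw hp) := inferInstanceAs (AddCommGroup (garlingSpace 𝕜 w p hp))

instance : Module 𝕜 (GarlingF 𝕜 hw hp) := inferInstanceAs (Module 𝕜 (garlingSpace 𝕜 w p hp))

variable (𝕜 hw hp) in
/-- The identity map from the Garling space. -/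
def equiv : garlingSpace 𝕜 w p hp ≃ₗ[𝕜] GarlingF 𝕜 hw hp := LinearEquiv.refl 𝕜 _

/-- The sequence of coordinates. -/
def coords : GarlingF 𝕜 hw hp →ₗ[𝕜] (ℕ → 𝕜) := (garlingSpace 𝕜 w p hp).subtype

theorem coords_injective : Function.Injective (coords : GarlingF 𝕜 hw hp → ℕ → 𝕜) :=
  Subtype.val_injective

/-- `‖x‖_g ^ p`. -/
noncomputable def modulus (x : GarlingF 𝕜 hw hp) : ℝ := (garlingENorm w p (coords x) ^ p).toReal

theorem garlingENorm_coords_lt_top (x : GarlingF 𝕜 hw hp) : garlingENorm w p (coords x) < ∞ :=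
  x.2

theorem modulus_nonneg (x : GarlingF 𝕜 hw hp) : 0 ≤ modulus x := ENNReal.toReal_nonneg

theorem shiftedSum_le_modulus (S : Finset ℕ) (x : GarlingF 𝕜 hw hp) :
    shiftedSum w p 0 S (coords x) ≤ modulus x := by
  rw [modulus, ← ENNReal.ofReal_le_iff_le_toReal
    (ENNReal.rpow_lt_top_of_nonneg hp.le (garlingENorm_coords_lt_top x).ne).ne,
    garlingENorm_rpow hw hp]
  exact le_iSup (fun S => ENNReal.ofReal (shiftedSum w p 0 S (coords x))) S

theorem modulus_le {x : GarlingF 𝕜 hw hp} {M : ℝ}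
    (h : ∀ S, shiftedSum w p 0 S (coords x) ≤ M) : modulus x ≤ M := by
  have hM : 0 ≤ M := (shiftedSum_nonneg hw 0 ∅ (coords x)).trans (h ∅)
  rw [modulus, garlingENorm_rpow hw hp]
  exact ENNReal.toReal_le_of_le_ofReal hM (iSup_le fun S => ENNReal.ofReal_le_ofReal (h S))

theorem exists_shiftedSum_gt {x : GarlingF 𝕜 hw hp} {M : ℝ} (h : M < modulus x) :
    ∃ S, M < shiftedSum w p 0 S (coords x) := by
  by_contra! H
  exact h.not_ge (modulus_le H)

theorem exists_coords_eq (f : ℕ → 𝕜) (M : ℝ) (h : ∀ S, shiftedSum w p 0 S f ≤ M) :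
    ∃ x : GarlingF 𝕜 hw hp, coords x = f :=
  ⟨⟨f, (garlingENorm_lt_top_iff hw hp f).2 ⟨M, h⟩⟩, rfl⟩

theorem norm_coords_rpow_le (x : GarlingF 𝕜 hw hp) (i : ℕ) : ‖coords x i‖ ^ p ≤ modulus x := by
  have := shiftedSum_le_modulus {i} x
  rwa [shiftedSum_singleton, hw.normalized, mul_one] at this

theorem modulus_zero : modulus (0 : GarlingF 𝕜 hw hp) = 0 := by
  simp [modulus, garlingENorm_zero w hp, hp]

theorem modulus_mono {x y : GarlingF 𝕜 hw hp} (h : ∀ i, ‖coords x i‖ ≤ ‖coords y i‖) :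
    modulus x ≤ modulus y :=
  modulus_le fun S => (shiftedSum_mono hw hp 0 fun i _ => h i).trans (shiftedSum_le_modulus S y)

theorem modulus_smul (c : 𝕜) (x : GarlingF 𝕜 hw hp) :
    modulus (c • x) = ‖c‖ ^ p * modulus x := by
  have key : ∀ (c : 𝕜) (x : GarlingF 𝕜 hw hp), modulus (c • x) ≤ ‖c‖ ^ p * modulus x :=
    fun c x => modulus_le fun S => by
      rw [map_smul, shiftedSum_smul]
      exact mul_le_mul_of_nonneg_left (shiftedSum_le_modulus S x)
        (Real.rpow_nonneg (norm_nonneg _) _)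
  refine le_antisymm (key c x) ?_
  rcases eq_or_ne c 0 with rfl | hc
  · rw [norm_zero, Real.zero_rpow hp.ne', zero_mul]
    exact modulus_nonneg _
  · have h := key c⁻¹ (c • x)
    rw [inv_smul_smul₀ hc, norm_inv, Real.inv_rpow (norm_nonneg _)] at h
    have h2 : 0 < ‖c‖ ^ p := Real.rpow_pos_of_pos (norm_pos_iff.2 hc) _
    rwa [inv_mul_eq_div, le_div_iff₀ h2, mul_comm] at h

theorem modulus_neg (x : GarlingF 𝕜 hw hp) : modulus (-x) = modulus x := by
  rw [← neg_one_smul 𝕜 x, modulus_smul, norm_neg, norm_one, Real.one_rpow, one_mul]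

/-- For p ≤ 1 the exponent is 1 and the modulus itself is subadditive; for p ≥ 1 it is 1/p and this
is Minkowski's inequality. -/
theorem modulus_rpow_add_le (x y : GarlingF 𝕜 hw hp) :
    modulus (x + y) ^ (min 1 p / p) ≤ modulus x ^ (min 1 p / p) + modulus y ^ (min 1 p / p) := by
  rcases le_total p 1 with h | h
  · rw [min_eq_right h, div_self hp.ne', Real.rpow_one, Real.rpow_one, Real.rpow_one]
    refine modulus_le fun S => ?_
    rw [map_add]
    exact (shiftedSum_add_le hw hp h 0 S _ _).trans
      (add_le_add (shiftedSum_le_modulus S x) (shiftedSum_le_modulus S y))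
  · rw [min_eq_left h]
    have hs : 0 ≤ modulus x ^ (1 / p) + modulus y ^ (1 / p) :=
      add_nonneg (Real.rpow_nonneg (modulus_nonneg _) _) (Real.rpow_nonneg (modulus_nonneg _) _)
    rw [one_div, Real.rpow_inv_le_iff_of_pos (modulus_nonneg _) (by simpa [one_div] using hs) hp,
      ← one_div]
    refine modulus_le fun S => ?_
    rw [map_add, ← Real.rpow_inv_le_iff_of_pos (shiftedSum_nonneg hw _ _ _) hs hp, ← one_div]
    refine (shiftedSum_rpow_add_le hw h 0 S _ _).trans (add_le_add ?_ ?_)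
    · exact Real.rpow_le_rpow (shiftedSum_nonneg hw _ _ _) (shiftedSum_le_modulus S x)
        (by positivity)
    · exact Real.rpow_le_rpow (shiftedSum_nonneg hw _ _ _) (shiftedSum_le_modulus S y)
        (by positivity)

theorem min_div_pos (hp : 0 < p) : 0 < min 1 p / p := div_pos (lt_min one_pos hp) hp

noncomputable instance : NormedAddCommGroup (GarlingF 𝕜 hw hp) :=
  AddGroupNorm.toNormedAddCommGroup
    { toFun := fun x => modulus x ^ (min 1 p / p)
      map_zero' := by rw [modulus_zero, Real.zero_rpow (min_div_pos hp).ne']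
      add_le' := modulus_rpow_add_le
      neg' := fun x => by rw [modulus_neg]
      eq_zero_of_map_eq_zero' := fun x hx => by
        rw [Real.rpow_eq_zero (modulus_nonneg x) (min_div_pos hp).ne'] at hx
        refine coords_injective (funext fun i => ?_)
        have h := norm_coords_rpow_le x i
        rw [hx] at h
        have h2 := le_antisymm h (Real.rpow_nonneg (norm_nonneg _) _)
        rw [Real.rpow_eq_zero (norm_nonneg _) hp.ne', norm_eq_zero] at h2
        rw [h2, map_zero, Pi.zero_apply] }

theorem norm_eq (x : GarlingF 𝕜 hw hp) : ‖x‖ = modulus x ^ (min 1 p / p) := rfl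

theorem norm_smul_eq (c : 𝕜) (x : GarlingF 𝕜 hw hp) : ‖c • x‖ = ‖c‖ ^ min 1 p * ‖x‖ := by
  rw [norm_eq, norm_eq, modulus_smul, Real.mul_rpow (Real.rpow_nonneg (norm_nonneg _) _)
    (modulus_nonneg _), ← Real.rpow_mul (norm_nonneg _), mul_div_cancel₀ _ hp.ne']

theorem norm_equiv (x : garlingSpace 𝕜 w p hp) :
    ‖equiv 𝕜 hw hp x‖ = ‖x‖ ^ min 1 p := by
  have h1 : ‖x‖ = (garlingENorm w p (x : ℕ → 𝕜)).toReal := rfl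
  have h2 : modulus (equiv 𝕜 hw hp x) = (garlingENorm w p (x : ℕ → 𝕜)).toReal ^ p := by
    rw [modulus, ENNReal.toReal_rpow]; rfl
  rw [norm_eq, h1, h2, ← Real.rpow_mul ENNReal.toReal_nonneg, mul_div_cancel₀ _ hp.ne']

theorem norm_le_iff {x : GarlingF 𝕜 hw hp} {M : ℝ} (hM : 0 ≤ M) :
    ‖x‖ ≤ M ^ (min 1 p / p) ↔ modulus x ≤ M :=
  Real.rpow_le_rpow_iff (modulus_nonneg _) hM (min_div_pos hp)

theorem norm_mono {x y : GarlingF 𝕜 hw hp} (h : ∀ i, ‖coords x i‖ ≤ ‖coords y i‖) :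
    ‖x‖ ≤ ‖y‖ :=
  (norm_le_iff (modulus_nonneg y)).2 (modulus_mono h)

theorem modulus_eq (x : GarlingF 𝕜 hw hp) : modulus x = ‖x‖ ^ (p / min 1 p) := by
  rw [norm_eq, ← Real.rpow_mul (modulus_nonneg _),
    div_mul_div_cancel₀ hp.ne', div_self (lt_min one_pos hp).ne', Real.rpow_one]

theorem norm_coords_le (x : GarlingF 𝕜 hw hp) (i : ℕ) : ‖coords x i‖ ^ min 1 p ≤ ‖x‖ := by
  have h := Real.rpow_le_rpow (Real.rpow_nonneg (norm_nonneg _) _) (norm_coords_rpow_le x i)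
    (min_div_pos hp).le
  rwa [← Real.rpow_mul (norm_nonneg _), mul_div_cancel₀ _ hp.ne'] at h

theorem exists_norm_le_of_modulus_le {ε : ℝ} (hε : 0 < ε) :
    ∃ δ > 0, ∀ x : GarlingF 𝕜 hw hp, modulus x ≤ δ → ‖x‖ ≤ ε := by
  refine ⟨ε ^ (p / min 1 p), Real.rpow_pos_of_pos hε _, fun x hx => ?_⟩
  rw [modulus_eq, Real.rpow_le_rpow_iff (norm_nonneg _) hε.le
    (div_pos hp (lt_min one_pos hp))] at hx
  exact hx

theorem exists_modulus_le_of_norm_le {ε : ℝ} (hε : 0 < ε) :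
    ∃ δ > 0, ∀ x : GarlingF 𝕜 hw hp, ‖x‖ ≤ δ → modulus x ≤ ε :=
  ⟨ε ^ (min 1 p / p), Real.rpow_pos_of_pos hε _, fun _ hx => (norm_le_iff hε.le).1 hx⟩

theorem tendsto_shiftedSum {f : ℕ → ℕ → 𝕜} {g : ℕ → 𝕜} (hp : 0 < p)
    (h : ∀ i, Tendsto (fun n => f n i) atTop (𝓝 (g i))) (S : Finset ℕ) :
    Tendsto (fun n => shiftedSum w p 0 S (f n)) atTop (𝓝 (shiftedSum w p 0 S g)) :=
  tendsto_finsetSum _ fun i _ => ((h i).norm.rpow_const (Or.inr hp.le)).mul_const _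

/-- Coordinates converge, and each finite sum depends continuously on finitely many of them, so
Cauchy estimates pass to the limit one set `S` at a time. -/
instance : CompleteSpace (GarlingF 𝕜 hw hp) := by
  refine Metric.complete_of_cauchySeq_tendsto fun u hu => ?_
  rw [Metric.cauchySeq_iff] at hu
  have hr : 0 < min 1 p := lt_min one_pos hp
  have hcoord : ∀ i, ∃ l, Tendsto (fun n => coords (u n) i) atTop (𝓝 l) := by
    intro i
    refine cauchySeq_tendsto_of_complete (Metric.cauchySeq_iff.2 fun ε hε => ?_)
    obtain ⟨N, hN⟩ := hu (ε ^ min 1 p) (Real.rpow_pos_of_pos hε _)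
    refine ⟨N, fun m hm n hn => ?_⟩
    have h1 := hN m hm n hn
    rw [dist_eq_norm] at h1 ⊢
    have h2 := (norm_coords_le (u m - u n) i).trans_lt h1
    rw [Real.rpow_lt_rpow_iff (norm_nonneg _) hε.le hr, map_sub, Pi.sub_apply] at h2
    exact h2
  choose a ha using hcoord
  have key : ∀ ε > 0, ∃ N, ∀ m ≥ N, ∀ S, shiftedSum w p 0 S (coords (u m) - a) ≤ ε := by
    intro ε hε
    obtain ⟨δ, hδ, hδ'⟩ := exists_modulus_le_of_norm_le (𝕜 := 𝕜) (hw := hw) (hp := hp) hε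
    obtain ⟨N, hN⟩ := hu δ hδ
    refine ⟨N, fun m hm S => ?_⟩
    have h1 : Tendsto (fun n => shiftedSum w p 0 S (coords (u m - u n))) atTop
        (𝓝 (shiftedSum w p 0 S (coords (u m) - a))) := by
      refine tendsto_shiftedSum hp (fun i => ?_) S
      simp only [map_sub, Pi.sub_apply]
      exact tendsto_const_nhds.sub (ha i)
    refine le_of_tendsto h1 (eventually_atTop.2 ⟨N, fun n hn => ?_⟩)
    refine (shiftedSum_le_modulus S _).trans (hδ' _ ?_)
    rw [← dist_eq_norm]
    exact (hN m hm n hn).le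
  -- One such estimate already places the coordinatewise limit in the space, as the difference of `u
  -- N` and an element with bounded sums.
  obtain ⟨N, hN⟩ := key 1 one_pos
  obtain ⟨z, hz⟩ := exists_coords_eq (hw := hw) (hp := hp) _ _ (hN N le_rfl)
  have hx : coords (u N - z) = a := by rw [map_sub, hz, sub_sub_cancel]
  refine ⟨u N - z, Metric.tendsto_atTop.2 fun ε hε => ?_⟩
  obtain ⟨δ, hδ, hδ'⟩ := exists_norm_le_of_modulus_le (𝕜 := 𝕜) (hw := hw) (hp := hp) (half_pos hε)
  obtain ⟨M, hM⟩ := key δ hδ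
  refine ⟨M, fun m hm => ?_⟩
  rw [dist_eq_norm]
  refine (hδ' _ (modulus_le fun S => ?_)).trans_lt (half_lt_self hε)
  rw [map_sub, hx]
  exact hM m hm S

theorem norm_sum_rpow_le_of_disjoint {ι : Type*} (hp : 0 < p) (A : Finset ι) (u : ι → 𝕜)
    (h : ∀ k ∈ A, ∀ l ∈ A, u k ≠ 0 → u l ≠ 0 → k = l) :
    ‖∑ k ∈ A, u k‖ ^ p ≤ ∑ k ∈ A, ‖u k‖ ^ p := by
  have hnn : ∀ k ∈ A, 0 ≤ ‖u k‖ ^ p := fun k _ => Real.rpow_nonneg (norm_nonneg _) _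
  by_cases H : ∃ k ∈ A, u k ≠ 0
  · obtain ⟨k, hk, hk0⟩ := H
    rw [Finset.sum_eq_single_of_mem k hk fun l hl hlk => by
      by_contra h0
      exact hlk (h l hl k hk h0 hk0)]
    exact Finset.single_le_sum hnn hk
  · push Not at H
    rw [Finset.sum_eq_zero H, norm_zero, Real.zero_rpow hp.ne']
    exact Finset.sum_nonneg hnn

theorem shiftedSum_sum_le {ι : Type*} (N : ℕ) (S : Finset ℕ) (A : Finset ι)
    (x : ι → GarlingF 𝕜 hw hp)
    (h : ∀ i, ∀ k ∈ A, ∀ l ∈ A, coords (x k) i ≠ 0 → coords (x l) i ≠ 0 → k = l) :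
    shiftedSum w p N S (coords (∑ k ∈ A, x k)) ≤ ∑ k ∈ A, shiftedSum w p N S (coords (x k)) := by
  refine shiftedSum_le_sum hw N S A _ (fun k => coords (x k)) fun i _ => ?_
  rw [map_sum, Finset.sum_apply]
  exact norm_sum_rpow_le_of_disjoint hp A _ (h i)

/-- The upper p-estimate: at each coordinate at most one summand is non-zero, so p-th powers add for
every `S`, whatever p is. -/
theorem modulus_sum_le {ι : Type*} (A : Finset ι) (x : ι → GarlingF 𝕜 hw hp)
    (h : ∀ i, ∀ k ∈ A, ∀ l ∈ A, coords (x k) i ≠ 0 → coords (x l) i ≠ 0 → k = l) :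
    modulus (∑ k ∈ A, x k) ≤ ∑ k ∈ A, modulus (x k) :=
  modulus_le fun S => (shiftedSum_sum_le 0 S A x h).trans
    (Finset.sum_le_sum fun k _ => shiftedSum_le_modulus S (x k))

theorem modulus_le_modulus_sum {ι : Type*} (A : Finset ι) (x : ι → GarlingF 𝕜 hw hp)
    (h : ∀ i, ∀ k ∈ A, ∀ l ∈ A, coords (x k) i ≠ 0 → coords (x l) i ≠ 0 → k = l)
    {k : ι} (hk : k ∈ A) : modulus (x k) ≤ modulus (∑ l ∈ A, x l) := by
  refine modulus_mono fun i => ?_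
  rcases eq_or_ne (coords (x k) i) 0 with h0 | h0
  · rw [h0, norm_zero]
    exact norm_nonneg _
  · rw [map_sum, Finset.sum_apply, Finset.sum_eq_single_of_mem k hk fun l hl hlk => by
      by_contra h1
      exact hlk (h i l hl k hk h1 h0)]

theorem summable_smul_of_disjoint (x : ℕ → GarlingF 𝕜 hw hp)
    (h : ∀ i k l, coords (x k) i ≠ 0 → coords (x l) i ≠ 0 → k = l) {C : ℝ}
    (hC : ∀ k, modulus (x k) ≤ C) {a : ℕ → 𝕜} (ha : Summable fun k => ‖a k‖ ^ p) :
    Summable fun k => a k • x k := by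
  rw [summable_iff_vanishing_norm]
  intro ε hε
  obtain ⟨δ, hδ, hδ'⟩ := exists_norm_le_of_modulus_le (𝕜 := 𝕜) (hw := hw) (hp := hp) (half_pos hε)
  obtain ⟨s, hs⟩ := summable_iff_vanishing_norm.1 (ha.mul_left C) δ hδ
  refine ⟨s, fun t ht => (hδ' _ ?_).trans_lt (half_lt_self hε)⟩
  refine (modulus_sum_le t _ fun i k _ l _ hk hl => h i k l ?_ ?_).trans ?_
  · rw [map_smul, Pi.smul_apply] at hk
    exact right_ne_zero_of_smul hk
  · rw [map_smul, Pi.smul_apply] at hl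
    exact right_ne_zero_of_smul hl
  · refine le_trans (Finset.sum_le_sum fun k _ => ?_) ((le_abs_self _).trans (hs t ht).le)
    rw [modulus_smul, mul_comm]
    exact mul_le_mul_of_nonneg_right (hC k) (Real.rpow_nonneg (norm_nonneg _) _)

/-- The restriction of a sequence to a set of indices. -/
noncomputable def restrict (s : Set ℕ) (x : GarlingF 𝕜 hw hp) : GarlingF 𝕜 hw hp :=
  ⟨s.indicator (coords x), (garlingENorm_lt_top_iff hw hp _).2 ⟨modulus x, fun S =>
    (shiftedSum_mono hw hp 0 fun _ _ => norm_indicator_le_norm_self _ _).trans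
      (shiftedSum_le_modulus S x)⟩⟩

theorem coords_restrict (s : Set ℕ) (x : GarlingF 𝕜 hw hp) :
    coords (restrict s x) = s.indicator (coords x) := rfl

theorem norm_restrict_mono {s t : Set ℕ} (hst : s ⊆ t) (x : GarlingF 𝕜 hw hp) :
    ‖restrict s x‖ ≤ ‖restrict t x‖ :=
  norm_mono fun i => by
    rw [coords_restrict, coords_restrict]
    exact norm_indicator_le_of_subset hst _ _

/-- Infinitely many entries above η would force the modulus to exceed η times every partial sum of
the divergent series of weights. -/
theorem eventually_norm_coords_rpow_le (x : GarlingF 𝕜 hw hp) {η : ℝ} (hη : 0 < η) :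
    ∃ N, ∀ i ≥ N, ‖coords x i‖ ^ p ≤ η := by
  by_contra! H
  have hinf : {i | η < ‖coords x i‖ ^ p}.Infinite := by
    refine Set.infinite_of_not_bddAbove fun ⟨b, hb⟩ => ?_
    obtain ⟨i, hi, hi'⟩ := H (b + 1)
    have : i ≤ b := hb hi'
    lia
  obtain ⟨n, hn⟩ := ((hw.tendsto_sum.const_mul_atTop hη).eventually_gt_atTop (modulus x)).exists
  obtain ⟨S, hS, rfl⟩ := hinf.exists_subset_card_eq n
  exact hn.not_ge ((mul_sum_range_le_shiftedSum hw S _ fun i hi => (hS hi).le).trans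
    (shiftedSum_le_modulus S x))

/-- If tails stayed large, far-out finite sets would give a fixed amount at any prescribed shift,
because the entries tend to zero and shifting small entries is cheap. Placing such sets one after
another would make the modulus infinite. -/
theorem exists_norm_restrict_Ici_le (x : GarlingF 𝕜 hw hp) {ε : ℝ} (hε : 0 < ε) :
    ∃ N, ‖restrict (Set.Ici N) x‖ ≤ ε := by
  obtain ⟨c, hc, hc'⟩ := exists_norm_le_of_modulus_le (𝕜 := 𝕜) (hw := hw) (hp := hp) hε
  suffices H : ∃ N, modulus (restrict (Set.Ici N) x) ≤ c from H.imp fun N hN => hc' _ hN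
  by_contra! H
  have step : ∀ J b : ℕ, ∃ T : Finset ℕ, (∀ i ∈ T, b ≤ i) ∧
      c / 2 ≤ shiftedSum w p J T (coords x) := by
    intro J b
    obtain ⟨N, hN⟩ := eventually_norm_coords_rpow_le x
      (show 0 < c / (2 * (J + 1)) by positivity)
    obtain ⟨S, hS⟩ := exists_shiftedSum_gt (H (max b N))
    rw [coords_restrict] at hS
    set T := S.filter (max b N ≤ ·)
    have h1 := shiftedSum_le_of_subset hw hp 0 (Finset.filter_subset (max b N ≤ ·) S)
      ((Set.Ici (max b N)).indicator (coords x)) fun i hi hiT => by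
        rw [Set.indicator_of_notMem]
        intro h
        exact hiT (Finset.mem_filter.2 ⟨hi, h⟩)
    have h4 : shiftedSum w p 0 T ((Set.Ici (max b N)).indicator (coords x))
        = shiftedSum w p 0 T (coords x) :=
      shiftedSum_congr 0 fun i hi => Set.indicator_of_mem (Finset.mem_filter.1 hi).2 _
    rw [h4] at h1
    have h2 := shiftedSum_zero_le_add (p := p) hw J T (coords x)
      (show 0 ≤ c / (2 * (J + 1)) by positivity) fun i hi =>
        hN i ((le_max_right _ _).trans (Finset.mem_filter.1 hi).2)
    have h3 : c / (2 * (J + 1)) * J ≤ c / 2 := by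
      rw [div_mul_eq_mul_div, div_le_div_iff₀ (by positivity) (by positivity)]
      nlinarith
    exact ⟨T, fun i hi => (le_max_left _ _).trans (Finset.mem_filter.1 hi).2, by linarith⟩
  have iter : ∀ n : ℕ, ∃ S : Finset ℕ, n * (c / 2) ≤ shiftedSum w p 0 S (coords x) := by
    intro n
    induction n with
    | zero => exact ⟨∅, by simp [shiftedSum_empty]⟩
    | succ n ih =>
      obtain ⟨S, hS⟩ := ih
      -- `S.card` is exactly the shift felt by a set placed after `S`, so the gains add up.
      obtain ⟨T, hT, hT'⟩ := step S.card (S.sup id + 1)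
      refine ⟨S ∪ T, ?_⟩
      rw [shiftedSum_union 0 fun i hi j hj => ?_, zero_add]
      · push_cast
        linarith
      · have h1 : i ≤ S.sup id := Finset.le_sup (f := id) hi
        have h2 := hT j hj
        lia
  obtain ⟨n, hn⟩ := exists_nat_gt (modulus x / (c / 2))
  rw [div_lt_iff₀ (half_pos hc)] at hn
  obtain ⟨S, hS⟩ := iter n
  exact (hn.trans_le hS).not_ge (shiftedSum_le_modulus S x)

end GarlingF

end GarlingF

/-! ### Rearrangements and unconditional summability -/

section Rearrangements

theorem exists_perm_strictMono (key : ℕ → ℕ) (h : Function.Injective key) :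
    ∃ π : Equiv.Perm ℕ, StrictMono fun n => key (π n) := by
  classical
  have : Infinite (Set.range key) := (Set.infinite_range_of_injective h).to_subtype
  refine ⟨(Nat.Subtype.orderIsoOfNat (Set.range key)).toEquiv.trans
    (Equiv.ofInjective key h).symm, fun m n hmn => ?_⟩
  have hk : ∀ s : Set.range key, key ((Equiv.ofInjective key h).symm s) = s := fun s =>
    congrArg Subtype.val ((Equiv.ofInjective key h).apply_symm_apply s)
  simp only [Equiv.trans_apply, hk]
  exact (Nat.Subtype.orderIsoOfNat (Set.range key)).strictMono hmn

/-- The integers are sorted by the first set of the exhaustion that contains them, so that each set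
of the exhaustion becomes an initial segment. -/
theorem exists_perm_map_range (U : ℕ → Finset ℕ) (hU : Monotone U) (hcov : ∀ i, i ∈ U (i + 1)) :
    ∃ π : Equiv.Perm ℕ, ∀ n, (Finset.range (U n).card).map π.toEmbedding = U n := by
  have hex : ∀ i, ∃ n, i ∈ U n := fun i => ⟨_, hcov i⟩
  let level : ℕ → ℕ := fun i => Nat.find (hex i)
  have hlevel : ∀ i n, level i ≤ n ↔ i ∈ U n := fun i n =>
    ⟨fun h => hU h (Nat.find_spec (hex i)), fun h => Nat.find_min' (hex i) h⟩
  -- The gap between consecutive values of `g` exceeds every element of the new level, so the keys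
  -- `g (level i) + i` are ordered by level first.
  let g : ℕ → ℕ := fun n => ∑ m ∈ Finset.range (n + 1), ((U m).sup id + 1)
  have hg : Monotone g := fun m n hmn =>
    Finset.sum_le_sum_of_subset (Finset.range_mono (by lia))
  have hlt : ∀ i n, level i < n → g (level i) + i < g n := by
    intro i n hin
    have h1 : g (level i + 1) = g (level i) + ((U (level i + 1)).sup id + 1) :=
      Finset.sum_range_succ _ _
    have h2 : i ≤ (U (level i + 1)).sup id :=
      Finset.le_sup (f := id) ((hlevel i _).1 (Nat.le_succ _))
    have h3 : g (level i + 1) ≤ g n := hg hin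
    lia
  have hkey : ∀ i n, g (level i) + i < g (n + 1) ↔ i ∈ U n := by
    intro i n
    rw [← hlevel]
    refine ⟨fun h => ?_, fun h => hlt i _ (Nat.lt_succ_of_le h)⟩
    by_contra! h'
    have : g (n + 1) ≤ g (level i) := hg h'
    lia
  have hinj : Function.Injective fun i => g (level i) + i := by
    intro i j hij
    simp only at hij
    rcases lt_trichotomy (level i) (level j) with h | h | h
    · have := hlt i _ h
      lia
    · rw [h] at hij
      lia
    · have := hlt j _ h
      lia
  obtain ⟨π, hπ⟩ := exists_perm_strictMono _ hinj
  refine ⟨π, fun n => ?_⟩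
  have hex' : ∃ j, π j ∉ U n := by
    obtain ⟨i, hi⟩ := Infinite.exists_notMem_finset (U n)
    exact ⟨π.symm i, by simpa using hi⟩
  have hmem : ∀ j, j < Nat.find hex' ↔ π j ∈ U n := by
    intro j
    refine ⟨fun h => not_not.1 (Nat.find_min hex' h), fun h => ?_⟩
    by_contra! h'
    refine Nat.find_spec hex' ?_
    rw [← hkey] at h ⊢
    exact (hπ.monotone h').trans_lt h
  have heq : (Finset.range (Nat.find hex')).map π.toEmbedding = U n := by
    ext i
    simp only [Finset.mem_map, Finset.mem_range, Equiv.coe_toEmbedding]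
    refine ⟨fun ⟨j, hj, hji⟩ => hji ▸ (hmem j).1 hj, fun h => ⟨π.symm i, ?_, by simp⟩⟩
    rw [hmem]
    simpa using h
  have hcard : (U n).card = Nat.find hex' := by
    have := congrArg Finset.card heq
    rw [Finset.card_map, Finset.card_range] at this
    exact this.symm
  rw [hcard, heq]

/-- If the Cauchy criterion failed, sets with sums of norm at least ε could be met one after another
by the initial segments of a single rearrangement. Its partial sums would not be Cauchy, the extra
term `f n` being negligible. -/
theorem summable_of_forall_perm_tendsto {X : Type*} [NormedAddCommGroup X] [CompleteSpace X]
    (f : ℕ → X)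
    (h : ∀ π : Equiv.Perm ℕ, ∃ s, Tendsto (fun n => ∑ i ∈ Finset.range n, f (π i)) atTop (𝓝 s)) :
    Summable f := by
  by_contra hf
  rw [summable_iff_vanishing_norm] at hf
  push Not at hf
  obtain ⟨ε, hε, hf⟩ := hf
  choose t ht htε using hf
  let U : ℕ → Finset ℕ := fun n =>
    Nat.rec ∅ (fun n V => insert n V ∪ t (insert n V)) n
  have hU1 : ∀ n, U (n + 1) = insert n (U n) ∪ t (insert n (U n)) := fun n => rfl
  have hmono : Monotone U := monotone_nat_of_le_succ fun n => by
    rw [hU1]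
    exact (Finset.subset_insert n (U n)).trans Finset.subset_union_left
  have hcov : ∀ i, i ∈ U (i + 1) := fun i => by
    rw [hU1]
    exact Finset.mem_union_left _ (Finset.mem_insert_self _ _)
  obtain ⟨π, hπ⟩ := exists_perm_map_range U hmono hcov
  have hsum : ∀ n, ∑ i ∈ Finset.range (U n).card, f (π i) = ∑ i ∈ U n, f i := by
    intro n
    conv_rhs => rw [← hπ n]
    rw [Finset.sum_map]
    rfl
  have hcard : ∀ n, n ≤ (U n).card := by
    intro n
    have : Finset.range n ⊆ U n := fun i hi =>
      hmono (Nat.succ_le_of_lt (Finset.mem_range.1 hi)) (hcov i)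
    simpa using Finset.card_le_card this
  obtain ⟨s, hs⟩ := h 1
  obtain ⟨s', hs'⟩ := h π
  have h1 : Tendsto f atTop (𝓝 0) := by
    have := (hs.comp (tendsto_add_atTop_nat 1)).sub hs
    simpa [Function.comp_def, Finset.sum_range_succ] using this
  have h2 : Tendsto (fun n => ∑ i ∈ U n, f i) atTop (𝓝 s') := by
    have := hs'.comp (tendsto_atTop_mono hcard tendsto_id)
    simpa [Function.comp_def, hsum] using this
  have h3 := (h2.comp (tendsto_add_atTop_nat 1)).sub h2
  rw [sub_self] at h3
  have h4 : ∀ᶠ n in atTop, ‖f n‖ < ε / 2 := by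
    have := h1.norm
    rw [norm_zero] at this
    exact this.eventually_lt_const (half_pos hε)
  have h5 : ∀ᶠ n in atTop, ‖∑ i ∈ U (n + 1), f i - ∑ i ∈ U n, f i‖ < ε / 2 := by
    have := h3.norm
    rw [norm_zero] at this
    exact this.eventually_lt_const (half_pos hε)
  obtain ⟨n, hn4, hn5⟩ := (h4.and h5).exists
  have h6 : ‖∑ i ∈ insert n (U n), f i - ∑ i ∈ U n, f i‖ ≤ ‖f n‖ := by
    rcases Classical.em (n ∈ U n) with hn | hn
    · rw [Finset.insert_eq_of_mem hn, sub_self, norm_zero]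
      exact norm_nonneg _
    · rw [Finset.sum_insert hn, add_sub_cancel_right]
  have h7 : ∑ i ∈ U (n + 1), f i
      = ∑ i ∈ insert n (U n), f i + ∑ i ∈ t (insert n (U n)), f i := by
    rw [hU1, Finset.sum_union (ht _).symm]
  have h8 : ∑ i ∈ t (insert n (U n)), f i = (∑ i ∈ U (n + 1), f i - ∑ i ∈ U n, f i)
      - (∑ i ∈ insert n (U n), f i - ∑ i ∈ U n, f i) := by
    rw [h7]; abel
  have h9 := htε (insert n (U n))
  rw [h8] at h9
  have := norm_sub_le (∑ i ∈ U (n + 1), f i - ∑ i ∈ U n, f i)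
    (∑ i ∈ insert n (U n), f i - ∑ i ∈ U n, f i)
  linarith

end Rearrangements

/-! ### Expansions with bounded partial sums in F-normed spaces -/

section FNorm

variable {𝕜 : Type*} [RCLike 𝕜] {X : Type*} [NormedAddCommGroup X] [Module 𝕜 X] {r : ℝ}

theorem seriesConvergesTo_iff (y : ℕ → X) (a : ℕ → 𝕜) (x : X) :
    SeriesConvergesTo 𝕜 y a x ↔
      Tendsto (fun n => ∑ i ∈ Finset.range n, a i • y i) atTop (𝓝 x) :=
  (tendsto_congr fun _ => norm_sub_rev x _).trans tendsto_iff_norm_sub_tendsto_zero.symm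

theorem SeriesConvergesTo.tendsto_zero {y : ℕ → X} {a : ℕ → 𝕜} {x : X}
    (h : SeriesConvergesTo 𝕜 y a x) : Tendsto (fun n => a n • y n) atTop (𝓝 0) := by
  rw [seriesConvergesTo_iff] at h
  have := (h.comp (tendsto_add_atTop_nat 1)).sub h
  simpa [Function.comp_def, Finset.sum_range_succ] using this

theorem SeriesConvergesTo.sub {y : ℕ → X} {a b : ℕ → 𝕜} {x z : X}
    (h : SeriesConvergesTo 𝕜 y a x) (h' : SeriesConvergesTo 𝕜 y b z) :
    SeriesConvergesTo 𝕜 y (a - b) (x - z) := by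
  rw [seriesConvergesTo_iff] at h h' ⊢
  simpa [sub_smul] using h.sub h'

theorem HasSum.seriesConvergesTo {y : ℕ → X} {a : ℕ → 𝕜} {x : X}
    (h : HasSum (fun n => a n • y n) x) : SeriesConvergesTo 𝕜 y a x :=
  (seriesConvergesTo_iff y a x).2 h.tendsto_sum_nat

theorem exists_norm_rpow_eq (𝕜 : Type*) [RCLike 𝕜] (hr : 0 < r) {t : ℝ} (ht : 0 ≤ t) :
    ∃ c : 𝕜, ‖c‖ ^ r = t := by
  refine ⟨((t ^ r⁻¹ : ℝ) : 𝕜), ?_⟩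
  rw [RCLike.norm_ofReal, abs_of_nonneg (Real.rpow_nonneg ht _), Real.rpow_inv_rpow ht hr.ne']

theorem norm_expansion_term_le {y : ℕ → X} {a : ℕ → 𝕜} {C : ℝ}
    (h : ∀ N, ‖∑ i ∈ Finset.range N, a i • y i‖ ≤ C) (i : ℕ) : ‖a i • y i‖ ≤ 2 * C := by
  have h1 : a i • y i = ∑ j ∈ Finset.range (i + 1), a j • y j - ∑ j ∈ Finset.range i, a j • y j := by
    rw [Finset.sum_range_succ, add_sub_cancel_left]
  rw [h1]
  have := norm_sub_le (∑ j ∈ Finset.range (i + 1), a j • y j) (∑ j ∈ Finset.range i, a j • y j)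
  have h2 := h (i + 1)
  have h3 := h i
  linarith

/-- Vectors with an expansion whose partial sums are bounded by `C`. -/
def boundedExpansions (𝕜 : Type*) [RCLike 𝕜] [Module 𝕜 X] (y : ℕ → X) (C : ℝ) : Set X :=
  {x | ∃ a : ℕ → 𝕜, SeriesConvergesTo 𝕜 y a x ∧ ∀ N, ‖∑ i ∈ Finset.range N, a i • y i‖ ≤ C}

theorem sub_mem_boundedExpansions {y : ℕ → X} {C D : ℝ} {x z : X}
    (hx : x ∈ boundedExpansions 𝕜 y C) (hz : z ∈ boundedExpansions 𝕜 y D) :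
    x - z ∈ boundedExpansions 𝕜 y (C + D) := by
  obtain ⟨a, ha, ha'⟩ := hx
  obtain ⟨b, hb, hb'⟩ := hz
  refine ⟨a - b, ha.sub hb, fun N => ?_⟩
  simp only [Pi.sub_apply, sub_smul, Finset.sum_sub_distrib]
  exact (norm_sub_le _ _).trans (add_le_add (ha' N) (hb' N))

theorem smul_mem_boundedExpansions (hs : ∀ (c : 𝕜) (x : X), ‖c • x‖ = ‖c‖ ^ r * ‖x‖)
    {y : ℕ → X} {C : ℝ} {x : X} (c : 𝕜) (hx : x ∈ boundedExpansions 𝕜 y C) :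
    c • x ∈ boundedExpansions 𝕜 y (‖c‖ ^ r * C) := by
  obtain ⟨a, ha, ha'⟩ := hx
  have h : ∀ N, ∑ i ∈ Finset.range N, (c • a) i • y i
      = c • ∑ i ∈ Finset.range N, a i • y i := fun N => by
    simp only [Finset.smul_sum, Pi.smul_apply, smul_assoc]
  refine ⟨c • a, ?_, fun N => ?_⟩
  · have h1 : Tendsto (fun n => ‖c‖ ^ r * ‖x - ∑ i ∈ Finset.range n, a i • y i‖) atTop
        (𝓝 (‖c‖ ^ r * 0)) := Tendsto.const_mul _ ha
    rw [mul_zero] at h1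
    refine h1.congr fun n => ?_
    rw [h, ← smul_sub, hs]
  · rw [h, hs]
    exact mul_le_mul_of_nonneg_left (ha' N) (Real.rpow_nonneg (norm_nonneg _) _)

/-- The Baire half of the open mapping argument: the closures for integer bounds cover the space, so
one of them contains a ball, which is then moved to the origin and rescaled. -/
theorem exists_dense_boundedExpansions [CompleteSpace X] (hr : 0 < r)
    (hs : ∀ (c : 𝕜) (x : X), ‖c • x‖ = ‖c‖ ^ r * ‖x‖) {y : ℕ → X}
    (h : ∀ x, ∃ a : ℕ → 𝕜, SeriesConvergesTo 𝕜 y a x) :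
    ∃ M, 0 ≤ M ∧ ∀ x : X, ∃ u ∈ boundedExpansions 𝕜 y (M * ‖x‖), ‖x - u‖ ≤ ‖x‖ / 2 := by
  have hcover : ⋃ n : ℕ, closure (boundedExpansions 𝕜 y n) = Set.univ := by
    refine Set.eq_univ_of_forall fun x => Set.mem_iUnion.2 ?_
    obtain ⟨a, ha⟩ := h x
    obtain ⟨C, hC⟩ := ((seriesConvergesTo_iff y a x).1 ha).norm.bddAbove_range
    obtain ⟨n, hn⟩ := exists_nat_ge C
    exact ⟨n, subset_closure ⟨a, ha, fun N => (hC ⟨N, rfl⟩).trans hn⟩⟩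
  obtain ⟨n, z, hz⟩ := nonempty_interior_of_iUnion_of_closed (fun _ => isClosed_closure) hcover
  rw [mem_interior_iff_mem_nhds, Metric.mem_nhds_iff] at hz
  obtain ⟨ε, hε, hball⟩ := hz
  -- Subtracting approximations of z + x and of z recentres the ball at the origin and doubles the
  -- bound.
  have stepA : ∀ x : X, ‖x‖ < ε → ∀ η > 0, ∃ u ∈ boundedExpansions 𝕜 y ((n : ℝ) + n),
      ‖x - u‖ < η := by
    intro x hx η hη
    have h1 : z + x ∈ closure (boundedExpansions 𝕜 y n) := hball (by simpa using hx)
    have h2 : z ∈ closure (boundedExpansions 𝕜 y n) := hball (Metric.mem_ball_self hε)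
    rw [Metric.mem_closure_iff] at h1 h2
    obtain ⟨u, hu, hu'⟩ := h1 (η / 2) (half_pos hη)
    obtain ⟨v, hv, hv'⟩ := h2 (η / 2) (half_pos hη)
    refine ⟨u - v, sub_mem_boundedExpansions hu hv, ?_⟩
    rw [dist_eq_norm] at hu' hv'
    have h3 : x - (u - v) = (z + x - u) - (z - v) := by abel
    rw [h3]
    have := norm_sub_le (z + x - u) (z - v)
    linarith
  refine ⟨((n : ℝ) + n) * 2 / ε, by positivity, fun x => ?_⟩
  rcases eq_or_ne x 0 with rfl | hx
  · refine ⟨0, ⟨0, ?_, ?_⟩, ?_⟩ <;> simp [SeriesConvergesTo]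
  have hx0 : 0 < ‖x‖ := norm_pos_iff.2 hx
  -- This scalar brings `x` to norm ε/2; an error of ε/4 there becomes ‖x‖/2 after scaling back.
  obtain ⟨c, hc⟩ := exists_norm_rpow_eq 𝕜 hr (show 0 ≤ ε / (2 * ‖x‖) by positivity)
  have hc0 : c ≠ 0 := by
    rintro rfl
    rw [norm_zero, Real.zero_rpow hr.ne'] at hc
    exact (show (0 : ℝ) < ε / (2 * ‖x‖) by positivity).ne hc
  obtain ⟨u, hu, hu'⟩ := stepA (c • x) (by
    rw [hs, hc, div_mul_eq_mul_div, div_lt_iff₀ (by positivity)]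
    nlinarith) (ε / 4) (by positivity)
  refine ⟨c⁻¹ • u, ?_, ?_⟩
  · have h1 := smul_mem_boundedExpansions hs c⁻¹ hu
    rw [norm_inv, Real.inv_rpow (norm_nonneg _), hc] at h1
    convert h1 using 1
    field_simp
  · have h1 : x - c⁻¹ • u = c⁻¹ • (c • x - u) := by rw [smul_sub, inv_smul_smul₀ hc0]
    rw [h1, hs, norm_inv, Real.inv_rpow (norm_nonneg _), hc]
    have h2 : (ε / (2 * ‖x‖))⁻¹ * (ε / 4) = ‖x‖ / 2 := by field_simp; norm_num
    rw [← h2]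
    exact mul_le_mul_of_nonneg_left hu'.le (by positivity)

theorem hasSum_smul_const (hr : 0 < r) (hs : ∀ (c : 𝕜) (x : X), ‖c • x‖ = ‖c‖ ^ r * ‖x‖)
    {ι : Type*} {a : ι → 𝕜} {b : 𝕜} (h : HasSum a b) (x : X) :
    HasSum (fun k => a k • x) (b • x) := by
  rw [HasSum, SummationFilter.unconditional_filter] at h ⊢
  rw [tendsto_iff_norm_sub_tendsto_zero] at h ⊢
  have h1 := (h.rpow_const (p := r) (Or.inr hr.le)).mul_const ‖x‖
  rw [Real.zero_rpow hr.ne', zero_mul] at h1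
  refine h1.congr fun s => ?_
  rw [← Finset.sum_smul, ← sub_smul, hs]

end FNorm

/-! ### Basis constants, unconditionality and semi-normalization -/

section FNorm

variable {𝕜 : Type*} [RCLike 𝕜] {X : Type*} [NormedAddCommGroup X] [Module 𝕜 X] {r : ℝ}

theorem hasSum_of_norm_sub_sum_le [CompleteSpace X] {u : ℕ → X} {x : X} {C : ℝ}
    (h : ∀ n, ‖x - ∑ k ∈ Finset.range n, u k‖ ≤ C * (1 / 2) ^ n)
    (hu : Summable fun k => ‖u k‖) : HasSum u x := by
  have h1 : Tendsto (fun n => ∑ k ∈ Finset.range n, u k) atTop (𝓝 x) := by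
    rw [tendsto_iff_norm_sub_tendsto_zero]
    have h2 : Tendsto (fun n : ℕ => C * (1 / 2 : ℝ) ^ n) atTop (𝓝 (C * 0)) :=
      (tendsto_pow_atTop_nhds_zero_of_lt_one (by norm_num) (by norm_num)).const_mul C
    rw [mul_zero] at h2
    refine squeeze_zero (fun _ => norm_nonneg _) (fun n => ?_) h2
    rw [norm_sub_rev]
    exact h n
  rw [← tendsto_nhds_unique hu.of_norm.hasSum.tendsto_sum_nat h1]
  exact hu.of_norm.hasSum

/-- The completeness half of the open mapping argument: the remainders of successive approximations
halve, and the expansions of the approximants are added coefficientwise. -/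
theorem exists_forall_mem_boundedExpansions [CompleteSpace X] (hr : 0 < r)
    (hs : ∀ (c : 𝕜) (x : X), ‖c • x‖ = ‖c‖ ^ r * ‖x‖) {y : ℕ → X} (hy : ∀ i, y i ≠ 0)
    (h : ∀ x, ∃ a : ℕ → 𝕜, SeriesConvergesTo 𝕜 y a x) :
    ∃ K, 0 ≤ K ∧ ∀ x : X, x ∈ boundedExpansions 𝕜 y (K * ‖x‖) := by
  obtain ⟨M, hM, happ⟩ := exists_dense_boundedExpansions hr hs h
  refine ⟨M * 2, by positivity, fun x => ?_⟩
  choose u hu hux using happ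
  let rem : ℕ → X := fun n => Nat.rec x (fun _ z => z - u z) n
  have hrem1 : ∀ n, rem (n + 1) = rem n - u (rem n) := fun n => rfl
  have hrem : ∀ n, ‖rem n‖ ≤ ‖x‖ * (1 / 2) ^ n := by
    intro n
    induction n with
    | zero => simp [rem]
    | succ n ih =>
      rw [hrem1, pow_succ]
      have := hux (rem n)
      linarith
  have htel : ∀ n, x - ∑ k ∈ Finset.range n, u (rem k) = rem n := by
    intro n
    induction n with
    | zero => simp [rem]
    | succ n ih => rw [Finset.sum_range_succ, hrem1, ← ih]; abel
  have hgeom : HasSum (fun k : ℕ => M * ‖x‖ * (1 / 2 : ℝ) ^ k) (M * ‖x‖ * 2) :=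
    hasSum_geometric_two.mul_left _
  choose a ha hab using fun k => hu (rem k)
  have hab' : ∀ k N, ‖∑ i ∈ Finset.range N, a k i • y i‖ ≤ M * ‖x‖ * (1 / 2) ^ k := fun k N => by
    refine (hab k N).trans ?_
    rw [mul_assoc]
    exact mul_le_mul_of_nonneg_left (hrem k) hM
  have hun : ∀ k, ‖u (rem k)‖ ≤ M * ‖x‖ * (1 / 2) ^ k := fun k =>
    le_of_tendsto ((seriesConvergesTo_iff _ _ _).1 (ha k)).norm (Eventually.of_forall (hab' k))
  have hsumu : HasSum (fun k => u (rem k)) x :=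
    hasSum_of_norm_sub_sum_le (C := ‖x‖) (fun n => (htel n).symm ▸ hrem n)
      (hgeom.summable.of_nonneg_of_le (fun _ => norm_nonneg _) hun)
  -- Each term of an expansion is bounded by twice the bound on its partial sums. As `y i` is
  -- non-zero, the i-th coefficients decay geometrically, with ratio (1/2)^(1/r) since the norm is
  -- r-homogeneous.
  have hsuma : ∀ i, Summable fun k => a k i := by
    intro i
    have hyi : 0 < ‖y i‖ := norm_pos_iff.2 (hy i)
    have hD : 0 ≤ 2 * (M * ‖x‖) / ‖y i‖ := by positivity
    have hρ : ((1 / 2 : ℝ) ^ r⁻¹) < 1 :=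
      Real.rpow_lt_one (by norm_num) (by norm_num) (inv_pos.2 hr)
    refine Summable.of_norm_bounded
      (g := fun k : ℕ => (2 * (M * ‖x‖) / ‖y i‖) ^ r⁻¹ * ((1 / 2 : ℝ) ^ r⁻¹) ^ k)
      ((summable_geometric_of_lt_one (by positivity) hρ).mul_left _) fun k => ?_
    have h1 := norm_expansion_term_le (hab' k) i
    rw [hs] at h1
    have h2 : ((1 / 2 : ℝ) ^ r⁻¹) ^ k = ((1 / 2 : ℝ) ^ k) ^ r⁻¹ := by
      rw [← Real.rpow_natCast, ← Real.rpow_natCast, ← Real.rpow_mul (by norm_num),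
        ← Real.rpow_mul (by norm_num), mul_comm]
    rw [h2, ← Real.mul_rpow hD (by positivity), Real.le_rpow_inv_iff_of_pos (norm_nonneg _)
      (by positivity) hr, div_mul_eq_mul_div, le_div_iff₀ hyi]
    linarith
  have hpart : ∀ N, HasSum (fun k => ∑ i ∈ Finset.range N, a k i • y i)
      (∑ i ∈ Finset.range N, (∑' k, a k i) • y i) := fun N =>
    hasSum_sum fun i _ => hasSum_smul_const hr hs (hsuma i).hasSum (y i)
  refine ⟨fun i => ∑' k, a k i, ?_, fun N => ?_⟩
  · rw [seriesConvergesTo_iff]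
    -- The limit in `N` and the sum over `k` are exchanged under the summable bound M‖x‖2^(-k).
    have h1 := tendsto_tsum_of_dominated_convergence (𝓕 := atTop)
      (f := fun N k => ∑ i ∈ Finset.range N, a k i • y i) (g := fun k => u (rem k))
      hgeom.summable (fun k => (seriesConvergesTo_iff _ _ _).1 (ha k))
      (Eventually.of_forall fun N k => hab' k N)
    rw [hsumu.tsum_eq] at h1
    exact h1.congr fun N => (hpart N).tsum_eq
  · rw [← (hpart N).tsum_eq, mul_right_comm]
    exact tsum_of_norm_bounded hgeom fun k => hab' k N

theorem IsBasicSequence.ne_zero {y : ℕ → X} (hy : IsBasicSequence 𝕜 y) (i : ℕ) : y i ≠ 0 := by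
  intro hi
  obtain ⟨a, -, huniq⟩ := hy 0 fun ε hε => ⟨0, zero_mem _, by simpa⟩
  have h1 := huniq 0 (by simp [SeriesConvergesTo])
  have h2 := huniq (Pi.single i 1) (by
    have : ∀ n, ∑ j ∈ Finset.range n, (Pi.single i (1 : 𝕜) : ℕ → 𝕜) j • y j = 0 := fun n =>
      Finset.sum_eq_zero fun j _ => by
        rcases eq_or_ne j i with rfl | hj
        · rw [hi, smul_zero]
        · rw [Pi.single_eq_of_ne hj, zero_smul]
    simp [SeriesConvergesTo, this])
  have h3 := congrFun (h1.trans h2.symm) i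
  simp at h3

theorem SeriesConvergesTo.mem_closedSpan {y : ℕ → X} {a : ℕ → 𝕜} {x : X}
    (h : SeriesConvergesTo 𝕜 y a x) : x ∈ closedSpan 𝕜 y := by
  intro ε hε
  obtain ⟨n, hn⟩ := (h.eventually_lt_const hε).exists
  exact ⟨_, Submodule.sum_mem _ fun i _ =>
    Submodule.smul_mem _ _ (Submodule.subset_span ⟨i, rfl⟩), hn⟩

/-- The closed span is complete, so every vector in it has an expansion with controlled partial
sums, and by uniqueness it is the only expansion. -/
theorem IsBasicSequence.exists_basis_constant [CompleteSpace X] (hr : 0 < r)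
    (hs : ∀ (c : 𝕜) (x : X), ‖c • x‖ = ‖c‖ ^ r * ‖x‖) {y : ℕ → X} (hy : IsBasicSequence 𝕜 y) :
    ∃ K, 0 ≤ K ∧ ∀ x a, SeriesConvergesTo 𝕜 y a x →
      ∀ N, ‖∑ i ∈ Finset.range N, a i • y i‖ ≤ K * ‖x‖ := by
  have : ContinuousConstSMul 𝕜 X := ⟨fun c => AddMonoidHomClass.continuous_of_bound
    (DistribSMul.toAddMonoidHom X c) (‖c‖ ^ r) fun x => (hs c x).le⟩
  let Z : Submodule 𝕜 X := (Submodule.span 𝕜 (Set.range y)).topologicalClosure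
  have hZ : ∀ x, x ∈ Z ↔ x ∈ closedSpan 𝕜 y := fun x => by
    rw [← SetLike.mem_coe, Submodule.topologicalClosure_coe, Metric.mem_closure_iff]
    simp only [dist_eq_norm]
    rfl
  have : CompleteSpace Z := (Submodule.isClosed_topologicalClosure _).completeSpace_coe
  let yZ : ℕ → Z := fun i =>
    ⟨y i, Submodule.le_topologicalClosure _ (Submodule.subset_span ⟨i, rfl⟩)⟩
  have hsZ : ∀ (c : 𝕜) (x : Z), ‖c • x‖ = ‖c‖ ^ r * ‖x‖ := fun c x => hs c x
  have hcoe : ∀ (a : ℕ → 𝕜) N, ((∑ i ∈ Finset.range N, a i • yZ i : Z) : X)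
      = ∑ i ∈ Finset.range N, a i • y i := fun a N => by
    rw [Submodule.coe_sum]
    rfl
  have hconv : ∀ (a : ℕ → 𝕜) (x : Z), SeriesConvergesTo 𝕜 yZ a x ↔ SeriesConvergesTo 𝕜 y a x := by
    intro a x
    refine tendsto_congr fun n => ?_
    rw [← hcoe]
    rfl
  obtain ⟨K, hK, hK'⟩ := exists_forall_mem_boundedExpansions hr hsZ (y := yZ)
    (fun i h => hy.ne_zero i (congrArg Subtype.val h)) fun x => by
      obtain ⟨a, ha, -⟩ := hy x ((hZ x).1 x.2)
      exact ⟨a, (hconv a x).2 ha⟩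
  refine ⟨K, hK, fun x a ha N => ?_⟩
  have hx := ha.mem_closedSpan
  obtain ⟨b, hb, hb'⟩ := hK' ⟨x, (hZ x).2 hx⟩
  rw [hconv] at hb
  rw [(hy x hx).unique ha hb, ← hcoe]
  exact hb' N

/-- The rearranged sequence has the same closed span, so it expands `x`. Its coefficients are
continuous, by the basis constant, and are the expected ones on the finite sums converging to `x`.
-/
theorem seriesConvergesTo_perm [CompleteSpace X] (hr : 0 < r)
    (hs : ∀ (c : 𝕜) (x : X), ‖c • x‖ = ‖c‖ ^ r * ‖x‖) {y : ℕ → X} {a : ℕ → 𝕜} {x : X}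
    (h : SeriesConvergesTo 𝕜 y a x) (π : Equiv.Perm ℕ)
    (hπ : IsBasicSequence 𝕜 fun n => y (π n)) :
    SeriesConvergesTo 𝕜 (fun n => y (π n)) (fun n => a (π n)) x := by
  obtain ⟨K, hK, hK'⟩ := hπ.exists_basis_constant hr hs
  have hspan : closedSpan 𝕜 (fun n => y (π n)) = closedSpan 𝕜 y := by
    have : Set.range (fun n => y (π n)) = Set.range y := π.surjective.range_comp y
    rw [closedSpan, closedSpan, this]
  obtain ⟨b, hb, -⟩ := hπ x (hspan ▸ h.mem_closedSpan)
  suffices hba : b = fun n => a (π n) from hba ▸ hb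
  funext m
  let s : ℕ → X := fun N => ∑ i ∈ Finset.range N, a i • y i
  let c : ℕ → ℕ → 𝕜 := fun N i => if i < N then a i else 0
  have hc : ∀ N, SeriesConvergesTo 𝕜 (fun n => y (π n)) (fun n => c N (π n)) (s N) := by
    intro N
    refine HasSum.seriesConvergesTo ((Equiv.hasSum_iff π (f := fun i => c N i • y i)).2 ?_)
    have h1 : s N = ∑ i ∈ Finset.range N, c N i • y i :=
      Finset.sum_congr rfl fun i hi => by simp only [c, if_pos (Finset.mem_range.1 hi)]
    rw [h1]
    refine hasSum_sum_of_ne_finset_zero fun i hi => ?_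
    simp only [c, if_neg fun h => hi (Finset.mem_range.2 h), zero_smul]
  have hbound : ∀ N, π m < N → ‖(b m - a (π m)) • y (π m)‖ ≤ 2 * (K * ‖x - s N‖) := by
    intro N hN
    have h1 := norm_expansion_term_le (hK' _ _ (hb.sub (hc N))) m
    simpa only [Pi.sub_apply, c, if_pos hN] using h1
  have hlim : Tendsto (fun N => 2 * (K * ‖x - s N‖)) atTop (𝓝 0) := by
    have : Tendsto (fun N => ‖x - s N‖) atTop (𝓝 0) := h
    simpa using (this.const_mul K).const_mul 2
  have h0 := ge_of_tendsto hlim (eventually_atTop.2 ⟨π m + 1, fun N hN => hbound N hN⟩)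
  have h1 := norm_le_zero_iff.1 h0
  by_contra hne
  refine hπ.ne_zero m ?_
  have h2 := congrArg (fun z => (b m - a (π m))⁻¹ • z) h1
  simpa only [inv_smul_smul₀ (sub_ne_zero.2 hne), smul_zero] using h2

theorem IsSubsymmetricBasicSequence.summable [CompleteSpace X] (hr : 0 < r)
    (hs : ∀ (c : 𝕜) (x : X), ‖c • x‖ = ‖c‖ ^ r * ‖x‖) {y : ℕ → X}
    (hy : IsSubsymmetricBasicSequence 𝕜 y) {a : ℕ → 𝕜} {x : X}
    (h : SeriesConvergesTo 𝕜 y a x) : Summable fun n => a n • y n :=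
  summable_of_forall_perm_tendsto _ fun π => ⟨x, (seriesConvergesTo_iff _ _ _).1
    (seriesConvergesTo_perm hr hs h π (hy.unconditional π))⟩

theorem frequently_gt_of_not_bddAbove {f : ℕ → ℝ} (h : ¬ BddAbove (Set.range f)) (C : ℝ) :
    ∃ᶠ k in atTop, C < f k := by
  intro hC
  refine h (IsBoundedUnder.bddAbove_range ⟨C, ?_⟩)
  rw [eventually_map]
  exact hC.mono fun k hk => not_lt.1 hk

/-- Otherwise a subsequence satisfies ‖y_{φ(n)}‖ > 2^n ‖y_n‖. With coefficients making ‖a_n y_n‖ =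
2^(-n), the series along y converges while the terms along the subsequence exceed 1. -/
theorem IsSubsymmetricBasicSequence.exists_norm_le [CompleteSpace X] (hr : 0 < r)
    (hs : ∀ (c : 𝕜) (x : X), ‖c • x‖ = ‖c‖ ^ r * ‖x‖) {y : ℕ → X}
    (hy : IsSubsymmetricBasicSequence 𝕜 y) : ∃ C, ∀ n, ‖y n‖ ≤ C := by
  by_contra! H
  have hnb : ¬ BddAbove (Set.range fun n => ‖y n‖) := fun ⟨C, hC⟩ => by
    obtain ⟨n, hn⟩ := H C
    exact hn.not_ge (hC ⟨n, rfl⟩)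
  obtain ⟨φ, hφ, hφ'⟩ := extraction_forall_of_frequently
    fun n => frequently_gt_of_not_bddAbove hnb (2 ^ n * ‖y n‖)
  have hpos : ∀ n, 0 < ‖y n‖ := fun n => norm_pos_iff.2 (hy.basic.ne_zero n)
  choose a ha using fun n => exists_norm_rpow_eq 𝕜 hr
    (show 0 ≤ (1 / 2 : ℝ) ^ n / ‖y n‖ by have := hpos n; positivity)
  have hsum : Summable fun n => a n • y n := by
    refine Summable.of_norm ((summable_geometric_two).congr fun n => ?_)
    rw [hs, ha, div_mul_cancel₀ _ (hpos n).ne']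
  obtain ⟨x, hx⟩ := (hy.spreading φ hφ a).2 ⟨_, hsum.hasSum.seriesConvergesTo⟩
  have h1 := hx.tendsto_zero.norm
  rw [norm_zero] at h1
  obtain ⟨n, hn⟩ := (h1.eventually_lt_const one_pos).exists
  rw [hs, ha] at hn
  have h2 := hφ' n
  have h3 : (1 / 2 : ℝ) ^ n / ‖y n‖ * (2 ^ n * ‖y n‖) = 1 := by
    have := (hpos n).ne'
    field_simp
    rw [← mul_pow]; norm_num
  have := mul_lt_mul_of_pos_left h2 (show 0 < (1 / 2 : ℝ) ^ n / ‖y n‖ by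
    have := hpos n; positivity)
  linarith

/-- The same argument with the roles exchanged: ‖y_{φ(n)}‖ < 2^(-n) ‖y_n‖ and ‖a_n y_n‖ = 1. -/
theorem IsSubsymmetricBasicSequence.exists_le_norm [CompleteSpace X] (hr : 0 < r)
    (hs : ∀ (c : 𝕜) (x : X), ‖c • x‖ = ‖c‖ ^ r * ‖x‖) {y : ℕ → X}
    (hy : IsSubsymmetricBasicSequence 𝕜 y) : ∃ c > 0, ∀ n, c ≤ ‖y n‖ := by
  have hpos : ∀ n, 0 < ‖y n‖ := fun n => norm_pos_iff.2 (hy.basic.ne_zero n)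
  by_contra! H
  have hnb : ¬ BddAbove (Set.range fun n => ‖y n‖⁻¹) := fun ⟨C, hC⟩ => by
    obtain ⟨n, hn⟩ := H (max C 1)⁻¹ (by positivity)
    rw [lt_inv_comm₀ (hpos n) (by positivity)] at hn
    exact ((le_max_left _ _).trans_lt hn).not_ge (hC ⟨n, rfl⟩)
  obtain ⟨φ, hφ, hφ'⟩ := extraction_forall_of_frequently
    fun n => frequently_gt_of_not_bddAbove hnb (2 ^ n * ‖y n‖⁻¹)
  choose a ha using fun n => exists_norm_rpow_eq 𝕜 hr (inv_nonneg.2 (norm_nonneg (y n)))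
  have hsum : Summable fun n => a n • y (φ n) := by
    refine Summable.of_norm (summable_geometric_two.of_nonneg_of_le (fun _ => norm_nonneg _)
      fun n => ?_)
    rw [hs, ha]
    have h1 := hφ' n
    rw [lt_inv_comm₀ (by have := hpos n; positivity) (hpos _), mul_inv, inv_inv] at h1
    have h2 := mul_lt_mul_of_pos_left h1 (inv_pos.2 (hpos n))
    refine h2.le.trans_eq ?_
    have := (hpos n).ne'
    field_simp
    rw [← mul_pow]; norm_num
  obtain ⟨x, hx⟩ := (hy.spreading φ hφ a).1 ⟨_, hsum.hasSum.seriesConvergesTo⟩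
  have h1 := hx.tendsto_zero.norm
  rw [norm_zero] at h1
  obtain ⟨n, hn⟩ := (h1.eventually_lt_const one_pos).exists
  rw [hs, ha, inv_mul_cancel₀ (hpos n).ne'] at hn
  exact lt_irrefl _ hn

end FNorm

/-! ### Passing between the quasi-norm and its power -/

section Transfer

variable {𝕜 : Type*} [RCLike 𝕜] {X X' : Type*} [AddCommGroup X] [Module 𝕜 X] [Norm X]
  [AddCommGroup X'] [Module 𝕜 X'] [Norm X'] {r : ℝ}

theorem seriesConvergesTo_equiv_iff (hr : 0 < r) (e : X ≃ₗ[𝕜] X') (hnn : ∀ x : X, 0 ≤ ‖x‖)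
    (he : ∀ x, ‖e x‖ = ‖x‖ ^ r) (y : ℕ → X) (a : ℕ → 𝕜) (x : X) :
    SeriesConvergesTo 𝕜 (fun n => e (y n)) a (e x) ↔ SeriesConvergesTo 𝕜 y a x := by
  have h : ∀ n, ‖e x - ∑ i ∈ Finset.range n, a i • e (y i)‖
      = ‖x - ∑ i ∈ Finset.range n, a i • y i‖ ^ r := fun n => by
    rw [← he]; simp
  simp only [SeriesConvergesTo, h]
  constructor
  · intro h1
    have h2 := h1.rpow_const (p := r⁻¹) (Or.inr (inv_pos.2 hr).le)
    rw [Real.zero_rpow (inv_pos.2 hr).ne'] at h2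
    exact h2.congr fun n => Real.rpow_rpow_inv (hnn _) hr.ne'
  · intro h1
    have h2 := h1.rpow_const (p := r) (Or.inr hr.le)
    rwa [Real.zero_rpow hr.ne'] at h2

theorem exists_seriesConvergesTo_equiv_iff (hr : 0 < r) (e : X ≃ₗ[𝕜] X')
    (hnn : ∀ x : X, 0 ≤ ‖x‖) (he : ∀ x, ‖e x‖ = ‖x‖ ^ r) (y : ℕ → X) (a : ℕ → 𝕜) :
    (∃ s, SeriesConvergesTo 𝕜 (fun n => e (y n)) a s) ↔ ∃ s, SeriesConvergesTo 𝕜 y a s := by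
  rw [e.surjective.exists]
  simp only [seriesConvergesTo_equiv_iff hr e hnn he]

theorem mem_closedSpan_equiv_iff (hr : 0 < r) (e : X ≃ₗ[𝕜] X') (hnn : ∀ x : X, 0 ≤ ‖x‖)
    (he : ∀ x, ‖e x‖ = ‖x‖ ^ r) (y : ℕ → X) (x : X) :
    e x ∈ closedSpan 𝕜 (fun n => e (y n)) ↔ x ∈ closedSpan 𝕜 y := by
  have hspan : ∀ z, e z ∈ Submodule.span 𝕜 (Set.range fun n => e (y n)) ↔
      z ∈ Submodule.span 𝕜 (Set.range y) := by
    intro z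
    have h1 : (Set.range fun n => e (y n)) = e '' Set.range y := Set.range_comp e y
    rw [h1, ← LinearEquiv.coe_coe, Submodule.span_image, LinearEquiv.coe_coe,
      Submodule.mem_map_equiv]
    simp
  constructor
  · intro h ε hε
    obtain ⟨z, hz, hz'⟩ := h (ε ^ r) (Real.rpow_pos_of_pos hε _)
    obtain ⟨z, rfl⟩ := e.surjective z
    rw [← map_sub, he, Real.rpow_lt_rpow_iff (hnn _) hε.le hr] at hz'
    exact ⟨z, (hspan z).1 hz, hz'⟩
  · intro h ε hε
    obtain ⟨z, hz, hz'⟩ := h (ε ^ r⁻¹) (Real.rpow_pos_of_pos hε _)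
    refine ⟨e z, (hspan z).2 hz, ?_⟩
    rw [← map_sub, he]
    exact (Real.lt_rpow_inv_iff_of_pos (hnn _) hε.le hr).1 hz'

theorem IsBasicSequence.equiv (hr : 0 < r) (e : X ≃ₗ[𝕜] X') (hnn : ∀ x : X, 0 ≤ ‖x‖)
    (he : ∀ x, ‖e x‖ = ‖x‖ ^ r) {y : ℕ → X} (hy : IsBasicSequence 𝕜 y) :
    IsBasicSequence 𝕜 (fun n => e (y n)) := by
  intro x hx
  obtain ⟨x, rfl⟩ := e.surjective x
  simp only [seriesConvergesTo_equiv_iff hr e hnn he]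
  exact hy x ((mem_closedSpan_equiv_iff hr e hnn he y x).1 hx)

theorem IsSubsymmetricBasicSequence.equiv (hr : 0 < r) (e : X ≃ₗ[𝕜] X') (hnn : ∀ x : X, 0 ≤ ‖x‖)
    (he : ∀ x, ‖e x‖ = ‖x‖ ^ r) {y : ℕ → X} (hy : IsSubsymmetricBasicSequence 𝕜 y) :
    IsSubsymmetricBasicSequence 𝕜 (fun n => e (y n)) where
  basic := hy.basic.equiv hr e hnn he
  unconditional π := (hy.unconditional π).equiv hr e hnn he
  spreading φ hφ a := by
    rw [exists_seriesConvergesTo_equiv_iff hr e hnn he (fun n => y (φ n)),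
      exists_seriesConvergesTo_equiv_iff hr e hnn he]
    exact hy.spreading φ hφ a

end Transfer

/-! ### Series of unit vectors in ℓ_p, and interleaved pairs -/

theorem exists_seriesConvergesTo_lpUnitVectors_iff {𝕜 : Type*} [RCLike 𝕜] {p : ℝ} (hp : 0 < p)
    (a : ℕ → 𝕜) : (∃ t, SeriesConvergesTo 𝕜 (lpUnitVectors 𝕜 p) a t) ↔
      Summable fun n => ‖a n‖ ^ p := by
  have hp' : (ENNReal.ofReal p).toReal = p := ENNReal.toReal_ofReal hp.le
  have hpos : 0 < (ENNReal.ofReal p).toReal := hp'.symm ▸ hp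
  have hsum : ∀ n, ∑ i ∈ Finset.range n, a i • lpUnitVectors 𝕜 p i
      = ∑ i ∈ Finset.range n, lp.single (ENNReal.ofReal p) i (a i) := fun n =>
    Finset.sum_congr rfl fun i _ => by
      rw [lpUnitVectors, ← lp.single_smul, smul_eq_mul, mul_one]
  constructor
  · rintro ⟨t, ht⟩
    suffices hta : ∀ i, t i = a i by
      have := (memℓp_gen_iff hpos).1 (lp.memℓp t)
      rw [hp'] at this
      exact this.congr fun i => by rw [hta]
    intro i
    have h1 : ∀ᶠ n in atTop, ‖t i - a i‖ ≤ ‖t - ∑ j ∈ Finset.range n, a j • lpUnitVectors 𝕜 p j‖ := by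
      filter_upwards [eventually_gt_atTop i] with n hn
      refine le_of_eq_of_le ?_ (lp.norm_apply_le_norm (by simpa using hp) _ i)
      rw [hsum, lp.coeFn_sub, Pi.sub_apply, lp.coeFn_sum, Finset.sum_apply]
      simp only [lp.coeFn_single, Finset.sum_pi_single, Finset.mem_range, hn, if_true]
    exact sub_eq_zero.1 (norm_le_zero_iff.1 (ge_of_tendsto ht h1))
  · intro h
    let t : lp (fun _ : ℕ => 𝕜) (ENNReal.ofReal p) := ⟨a, memℓp_gen (by rwa [hp'])⟩
    refine ⟨t, ?_⟩
    -- An exact identity for p-th powers, which needs no triangle inequality and so covers p < 1.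
    have h1 : ∀ n, ‖t - ∑ i ∈ Finset.range n, a i • lpUnitVectors 𝕜 p i‖ ^ p
        = ‖t‖ ^ p - ∑ i ∈ Finset.range n, ‖a i‖ ^ p := by
      intro n
      have h2 := lp.norm_sub_norm_compl_sub_single hpos t (Finset.range n)
      rw [hp'] at h2
      rw [hsum, eq_sub_iff_add_eq', ← eq_sub_iff_add_eq]
      exact h2.symm
    have h3 : ‖t‖ ^ p = ∑' i, ‖a i‖ ^ p := by
      have := lp.norm_rpow_eq_tsum hpos t
      rwa [hp'] at this
    have h4 : Tendsto (fun n => ‖t - ∑ i ∈ Finset.range n, a i • lpUnitVectors 𝕜 p i‖ ^ p)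
        atTop (𝓝 0) := by
      simp only [h1, h3]
      simpa using (tendsto_const_nhds (x := ∑' i, ‖a i‖ ^ p)).sub h.hasSum.tendsto_sum_nat
    have h5 := h4.rpow_const (p := p⁻¹) (Or.inr (inv_pos.2 hp).le)
    rw [Real.zero_rpow (inv_pos.2 hp).ne'] at h5
    exact h5.congr fun n => Real.rpow_rpow_inv (lp.norm_nonneg' _) hp.ne'

/-- The sequence `2ψ(0), 2ψ(0) + 1, 2ψ(1), 2ψ(1) + 1, …`. -/
def pairIndex (ψ : ℕ → ℕ) (n : ℕ) : ℕ := 2 * ψ (n / 2) + n % 2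

theorem pairIndex_even (ψ : ℕ → ℕ) (n : ℕ) : pairIndex ψ (2 * n) = 2 * ψ n := by
  simp [pairIndex]

theorem pairIndex_odd (ψ : ℕ → ℕ) (n : ℕ) : pairIndex ψ (2 * n + 1) = 2 * ψ n + 1 := by
  have h1 : (2 * n + 1) / 2 = n := by lia
  have h2 : (2 * n + 1) % 2 = 1 := by lia
  rw [pairIndex, h1, h2]

/-- Makes a subsequence of the differences y_{2n} - y_{2n+1} again the sequence of paired
differences of a subsequence of y. -/
theorem StrictMono.pairIndex {ψ : ℕ → ℕ} (h : StrictMono ψ) : StrictMono (pairIndex ψ) := by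
  refine strictMono_nat_of_lt_succ fun n => ?_
  obtain ⟨m, rfl | rfl⟩ := Nat.even_or_odd' n
  · rw [pairIndex_even, pairIndex_odd]
    lia
  · rw [pairIndex_odd, show 2 * m + 1 + 1 = 2 * (m + 1) by ring, pairIndex_even]
    have := h (Nat.lt_succ_self m)
    simp only [Nat.succ_eq_add_one] at this
    lia

theorem tendsto_sum_alternating {X : Type*} [NormedAddCommGroup X] {z : ℕ → X} {x : X}
    (hz : Tendsto z atTop (𝓝 0))
    (h : Tendsto (fun n => ∑ i ∈ Finset.range n, (z (2 * i) + z (2 * i + 1))) atTop (𝓝 x)) :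
    Tendsto (fun n => ∑ i ∈ Finset.range n, z i) atTop (𝓝 x) := by
  have heven : ∀ n, ∑ i ∈ Finset.range (2 * n), z i
      = ∑ i ∈ Finset.range n, (z (2 * i) + z (2 * i + 1)) := by
    intro n
    induction n with
    | zero => simp
    | succ n ih =>
      rw [show 2 * (n + 1) = 2 * n + 1 + 1 by ring, Finset.sum_range_succ, Finset.sum_range_succ,
        ih, Finset.sum_range_succ, add_assoc]
  have hdiv : Tendsto (fun n : ℕ => n / 2) atTop atTop :=
    tendsto_atTop_atTop.2 fun b => ⟨2 * b, fun n hn => by lia⟩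
  have h1 := h.comp hdiv
  have h2 : Tendsto (fun n => ∑ i ∈ Finset.range n, z i
      - ∑ i ∈ Finset.range (n / 2), (z (2 * i) + z (2 * i + 1))) atTop (𝓝 0) := by
    have h3 : Tendsto (fun n : ℕ => ‖z (2 * (n / 2))‖) atTop (𝓝 0) := by
      have h4 : Tendsto (fun n : ℕ => 2 * (n / 2)) atTop atTop :=
        tendsto_atTop_atTop.2 fun b => ⟨2 * b, fun n hn => by lia⟩
      simpa using (hz.comp h4).norm
    refine squeeze_zero_norm (fun n => ?_) h3
    obtain ⟨m, rfl | rfl⟩ := Nat.even_or_odd' n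
    · rw [show 2 * m / 2 = m by lia, heven, sub_self, norm_zero]
      exact norm_nonneg _
    · rw [show (2 * m + 1) / 2 = m by lia, Finset.sum_range_succ, heven, add_sub_cancel_left]
  simpa using h2.add h1

/-! ### Lower and upper p-estimates -/

namespace GarlingF

variable {𝕜 : Type*} [RCLike 𝕜] {w : ℕ → ℝ} {p : ℝ} {hw : IsGarlingWeight w} {hp : 0 < p}

theorem min_one_pos (hp : 0 < p) : 0 < min 1 p := lt_min one_pos hp

/-- Consecutively supported vectors whose sums over large shifts stay bounded below satisfy a
lower `p`-estimate. -/
theorem exists_lower_estimate {t : ℕ → ℕ} (ht : Monotone t) {x : ℕ → GarlingF 𝕜 hw hp}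
    (hx : ∀ k j, coords (x k) j ≠ 0 → t k ≤ j ∧ j < t (k + 1)) {c : ℝ}
    (hS : ∀ k, ∃ S, c < shiftedSum w p (t k) S (coords (x k))) (a : ℕ → 𝕜) (m : ℕ) :
    ∃ S : Finset ℕ, (∀ i ∈ S, i < t m) ∧ c * ∑ k ∈ Finset.range m, ‖a k‖ ^ p
      ≤ shiftedSum w p 0 S (coords (∑ k ∈ Finset.range m, a k • x k)) := by
  induction m with
  | zero => exact ⟨∅, by simp, by simp [shiftedSum_empty]⟩
  | succ m ih =>
    obtain ⟨S, hSt, hS'⟩ := ih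
    obtain ⟨T, hT⟩ := hS m
    have hxz : ∀ k j, ¬ (t k ≤ j ∧ j < t (k + 1)) → coords (x k) j = 0 := fun k j h =>
      not_not.1 fun h0 => h (hx k j h0)
    set T' := T.filter fun j => t m ≤ j ∧ j < t (m + 1)
    have hT' : c < shiftedSum w p (t m) T' (coords (x m)) :=
      hT.trans_le (shiftedSum_le_of_subset hw hp _ (Finset.filter_subset _ _) _
        fun i hi hiT => hxz m i fun h => hiT (Finset.mem_filter.2 ⟨hi, h⟩))
    -- Only indices below `t m` precede the new block, so it is shifted by at most `t m`, where its
    -- sum is still above `c`.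
    have hcard : S.card ≤ t m := by
      simpa using Finset.card_le_card (fun i hi => Finset.mem_range.2 (hSt i hi) : S ⊆ Finset.range (t m))
    refine ⟨S ∪ T', fun i hi => ?_, ?_⟩
    · rcases Finset.mem_union.1 hi with h | h
      · exact (hSt i h).trans_le (ht (Nat.le_succ m))
      · exact (Finset.mem_filter.1 h).2.2
    · rw [shiftedSum_union 0 fun i hi j hj => (hSt i hi).trans_le (Finset.mem_filter.1 hj).2.1,
        Finset.sum_range_succ, mul_add, zero_add, Finset.sum_range_succ]
      refine add_le_add (hS'.trans_eq (shiftedSum_congr 0 fun i hi => ?_)) ?_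
      · rw [map_add, Pi.add_apply, map_smul, Pi.smul_apply,
          hxz m i fun h => (hSt i hi).not_ge h.1, smul_zero, add_zero]
      · have h1 : shiftedSum w p S.card T'
            (coords (∑ k ∈ Finset.range m, a k • x k + a m • x m))
            = shiftedSum w p S.card T' (a m • coords (x m)) := by
          refine shiftedSum_congr _ fun i hi => ?_
          rw [map_add, Pi.add_apply, map_smul, map_sum, Finset.sum_apply,
            Finset.sum_eq_zero, zero_add]
          intro k hk
          rw [map_smul, Pi.smul_apply, hxz k i, smul_zero]
          rintro ⟨-, h2⟩
          have h3 : t (k + 1) ≤ t m := ht (Finset.mem_range.1 hk)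
          have h4 := (Finset.mem_filter.1 hi).2.1
          lia
        rw [h1, shiftedSum_smul, mul_comm]
        exact mul_le_mul_of_nonneg_left (hT'.le.trans (shiftedSum_anti hw hcard T' _))
          (Real.rpow_nonneg (norm_nonneg _) _)

theorem summable_smul_sub {d x : ℕ → GarlingF 𝕜 hw hp} {a : ℕ → 𝕜} {A : ℝ}
    (ha : ∀ n, ‖a n‖ ^ min 1 p ≤ A) (hdx : Summable fun n => ‖d n - x n‖) :
    Summable fun n => a n • (d n - x n) := by
  refine Summable.of_norm ((hdx.mul_left A).of_nonneg_of_le (fun _ => norm_nonneg _) fun n => ?_)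
  rw [norm_smul_eq]
  exact mul_le_mul_of_nonneg_right (ha n) (norm_nonneg _)

/-- Spreading gives convergence along the even and the odd terms of the subsequence. Subtracting
them and removing the perturbation gives convergence along the blocks, where the lower estimate
applies. -/
theorem summable_rpow_of_seriesConvergesTo {y : ℕ → GarlingF 𝕜 hw hp}
    (hy : IsSubsymmetricBasicSequence 𝕜 y) {σ : ℕ → ℕ} (hσ : StrictMono σ)
    {x : ℕ → GarlingF 𝕜 hw hp}
    (hdx : Summable fun n => ‖y (σ (2 * n)) - y (σ (2 * n + 1)) - x n‖)
    {t : ℕ → ℕ} (ht : Monotone t)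
    (hx : ∀ k j, coords (x k) j ≠ 0 → t k ≤ j ∧ j < t (k + 1)) {c : ℝ} (hc : 0 < c)
    (hS : ∀ k, ∃ S, c < shiftedSum w p (t k) S (coords (x k))) {a : ℕ → 𝕜}
    (ha : ∃ s, SeriesConvergesTo 𝕜 y a s) : Summable fun n => ‖a n‖ ^ p := by
  obtain ⟨c', hc', hyc⟩ := hy.exists_le_norm (min_one_pos hp) norm_smul_eq
  obtain ⟨s1, hs1⟩ := (hy.spreading (fun n => σ (2 * n))
    (hσ.comp fun m n h => by lia) a).2 ha
  obtain ⟨s2, hs2⟩ := (hy.spreading (fun n => σ (2 * n + 1))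
    (hσ.comp fun m n h => by lia) a).2 ha
  obtain ⟨s, hs⟩ := ha
  obtain ⟨A, hA⟩ := hs.tendsto_zero.norm.bddAbove_range
  have haA : ∀ n, ‖a n‖ ^ min 1 p ≤ A / c' := fun n => by
    rw [le_div_iff₀ hc']
    refine le_trans ?_ (hA ⟨n, rfl⟩)
    dsimp only
    rw [norm_smul_eq]
    exact mul_le_mul_of_nonneg_left (hyc n) (Real.rpow_nonneg (norm_nonneg _) _)
  have h1 := (((seriesConvergesTo_iff _ _ _).1 hs1).sub ((seriesConvergesTo_iff _ _ _).1 hs2)).sub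
    (summable_smul_sub haA hdx).hasSum.tendsto_sum_nat
  have h2 : ∀ n, ∑ i ∈ Finset.range n, a i • y (σ (2 * i))
      - ∑ i ∈ Finset.range n, a i • y (σ (2 * i + 1))
      - ∑ i ∈ Finset.range n, a i • (y (σ (2 * i)) - y (σ (2 * i + 1)) - x i)
      = ∑ i ∈ Finset.range n, a i • x i := fun n => by
    rw [← Finset.sum_sub_distrib, ← Finset.sum_sub_distrib]
    refine Finset.sum_congr rfl fun i _ => ?_
    rw [← smul_sub, ← smul_sub, sub_sub_cancel]
  simp only [h2] at h1
  obtain ⟨C, hC⟩ := h1.norm.bddAbove_range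
  refine summable_of_sum_range_le (c := C ^ (p / min 1 p) / c)
    (fun n => Real.rpow_nonneg (norm_nonneg _) _) fun n => ?_
  obtain ⟨S, -, hS'⟩ := exists_lower_estimate ht hx hS a n
  rw [le_div_iff₀ hc, mul_comm]
  refine hS'.trans ((shiftedSum_le_modulus S _).trans ?_)
  rw [modulus_eq]
  exact Real.rpow_le_rpow (norm_nonneg _) (hC ⟨n, rfl⟩)
    (div_pos hp (min_one_pos hp)).le

/-- The upper estimate gives convergence along the blocks, hence along the differences, which are a
series along the subsequence with coefficients a_0, -a_0, a_1, -a_1, .... Spreading moves it to y,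
unconditionality keeps the even terms, and spreading again removes the gaps. -/
theorem exists_seriesConvergesTo_of_summable_rpow {y : ℕ → GarlingF 𝕜 hw hp}
    (hy : IsSubsymmetricBasicSequence 𝕜 y) {σ : ℕ → ℕ} (hσ : StrictMono σ)
    {x : ℕ → GarlingF 𝕜 hw hp}
    (hdx : Summable fun n => ‖y (σ (2 * n)) - y (σ (2 * n + 1)) - x n‖)
    (hx : ∀ i k l, coords (x k) i ≠ 0 → coords (x l) i ≠ 0 → k = l) {C : ℝ}
    (hxC : ∀ k, modulus (x k) ≤ C) {a : ℕ → 𝕜} (ha : Summable fun n => ‖a n‖ ^ p) :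
    ∃ s, SeriesConvergesTo 𝕜 y a s := by
  obtain ⟨D, hD⟩ := hy.exists_norm_le (min_one_pos hp) norm_smul_eq
  have ha0 : Tendsto (fun n => ‖a n‖ ^ min 1 p) atTop (𝓝 0) := by
    have h1 := ha.tendsto_atTop_zero.rpow_const (p := min 1 p / p) (Or.inr (min_div_pos hp).le)
    rw [Real.zero_rpow (min_div_pos hp).ne'] at h1
    refine h1.congr fun n => ?_
    rw [← Real.rpow_mul (norm_nonneg _), mul_div_cancel₀ _ hp.ne']
  obtain ⟨A, hA⟩ := ha0.bddAbove_range
  have hsum := (summable_smul_of_disjoint x hx hxC ha).add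
    (summable_smul_sub (fun n => hA ⟨n, rfl⟩) hdx)
  let b : ℕ → 𝕜 := fun n => if n % 2 = 0 then a (n / 2) else - a (n / 2)
  have hb0 : ∀ n, b (2 * n) = a n := fun n => by simp [b]
  have hb1 : ∀ n, b (2 * n + 1) = - a n := fun n => by
    have h1 : (2 * n + 1) / 2 = n := by lia
    simp [b, h1]
  have hbnorm : ∀ n, ‖b n‖ = ‖a (n / 2)‖ := fun n => by
    simp only [b]
    split_ifs
    · rfl
    · rw [norm_neg]
  have hz : Tendsto (fun n => b n • y (σ n)) atTop (𝓝 0) := by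
    have hdiv : Tendsto (fun n : ℕ => n / 2) atTop atTop :=
      tendsto_atTop_atTop.2 fun b => ⟨2 * b, fun n hn => by lia⟩
    have h1 := (ha0.comp hdiv).mul_const D
    rw [zero_mul] at h1
    refine squeeze_zero_norm (fun n => ?_) h1
    rw [norm_smul_eq, hbnorm]
    exact mul_le_mul_of_nonneg_left (hD _) (Real.rpow_nonneg (norm_nonneg _) _)
  have h1 := tendsto_sum_alternating hz (x := ∑' n, (a n • x n
      + a n • (y (σ (2 * n)) - y (σ (2 * n + 1)) - x n))) (by
    refine hsum.hasSum.tendsto_sum_nat.congr fun n => Finset.sum_congr rfl fun i _ => ?_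
    rw [hb0, hb1, ← smul_add, add_sub_cancel, smul_sub, neg_smul, sub_eq_add_neg])
  obtain ⟨z, hz⟩ := (hy.spreading σ hσ b).1 ⟨_, (seriesConvergesTo_iff _ _ _).2 h1⟩
  have h2 := (hy.summable (min_one_pos hp) norm_smul_eq hz).comp_injective
    (i := fun n => 2 * n) fun m n h => by dsimp only at h; lia
  refine (hy.spreading (fun n => 2 * n) (fun m n h => by dsimp only; lia) a).1
    ⟨_, HasSum.seriesConvergesTo (h2.hasSum.congr_fun fun n => ?_)⟩
  simp only [Function.comp_apply, hb0]

end GarlingF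

/-! ### Gliding hump: extraction of a block sequence -/

namespace GarlingF

variable {𝕜 : Type*} [RCLike 𝕜] {w : ℕ → ℝ} {p : ℝ} {hw : IsGarlingWeight w} {hp : 0 < p}

theorem exists_subseq_tendsto_coords {y : ℕ → GarlingF 𝕜 hw hp} {C : ℝ} (hC : ∀ n, ‖y n‖ ≤ C) :
    ∃ (φ : ℕ → ℕ) (l : ℕ → 𝕜), StrictMono φ ∧
      ∀ j, Tendsto (fun n => coords (y (φ n)) j) atTop (𝓝 (l j)) := by
  have hC0 : 0 ≤ C := (norm_nonneg _).trans (hC 0)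
  have hcompact : IsCompact (Set.univ.pi fun _ : ℕ => Metric.closedBall (0 : 𝕜)
      (C ^ (min 1 p)⁻¹)) := isCompact_univ_pi fun _ => isCompact_closedBall _ _
  obtain ⟨l, -, φ, hφ, hl⟩ := hcompact.tendsto_subseq (x := fun n => coords (y n)) fun n j _ => by
    rw [mem_closedBall_zero_iff, Real.le_rpow_inv_iff_of_pos (norm_nonneg _) hC0 (min_one_pos hp)]
    exact (norm_coords_le _ _).trans (hC n)
  exact ⟨φ, l, hφ, tendsto_pi_nhds.1 hl⟩

theorem tendsto_norm_restrict_Iio {d : ℕ → GarlingF 𝕜 hw hp}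
    (hd : ∀ j, Tendsto (fun n => coords (d n) j) atTop (𝓝 0)) (N : ℕ) :
    Tendsto (fun n => ‖restrict (Set.Iio N) (d n)‖) atTop (𝓝 0) := by
  have h1 : Tendsto (fun n => ∑ j ∈ Finset.range N, ‖coords (d n) j‖ ^ p) atTop (𝓝 0) := by
    have h2 := tendsto_finsetSum (Finset.range N) fun j _ =>
      ((hd j).norm.rpow_const (p := p) (Or.inr hp.le))
    simpa [Real.zero_rpow hp.ne'] using h2
  have h3 := h1.rpow_const (p := min 1 p / p) (Or.inr (min_div_pos hp).le)
  rw [Real.zero_rpow (min_div_pos hp).ne'] at h3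
  refine squeeze_zero (fun _ => norm_nonneg _) (fun n => ?_) h3
  rw [norm_le_iff (Finset.sum_nonneg fun _ _ => Real.rpow_nonneg (norm_nonneg _) _)]
  refine modulus_le fun S => ?_
  refine (shiftedSum_le_of_subset hw hp 0 (Finset.filter_subset (· < N) S) _
    fun i hi hiN => ?_).trans ?_
  · rw [coords_restrict, Set.indicator_of_notMem]
    exact fun h => hiN (Finset.mem_filter.2 ⟨hi, h⟩)
  · refine le_trans (Finset.sum_le_sum fun i hi => ?_) (Finset.sum_le_sum_of_subset_of_nonneg
      (s := S.filter (· < N)) (f := fun j => ‖coords (d n) j‖ ^ p)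
      (fun i hi => Finset.mem_range.2 (Finset.mem_filter.1 hi).2)
      fun _ _ _ => Real.rpow_nonneg (norm_nonneg _) _)
    rw [coords_restrict, Set.indicator_of_mem (show i ∈ Set.Iio N from (Finset.mem_filter.1 hi).2)]
    exact mul_le_of_le_one_right (Real.rpow_nonneg (norm_nonneg _) _) (hw.le_one _)

theorem sub_restrict_Ico (x : GarlingF 𝕜 hw hp) {m n : ℕ} (h : m ≤ n) :
    x - restrict (Set.Ico m n) x = restrict (Set.Iio m) x + restrict (Set.Ici n) x := by
  refine coords_injective (funext fun j => ?_)
  simp only [map_sub, map_add, coords_restrict, Pi.sub_apply, Pi.add_apply, Set.indicator_apply,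
    Set.mem_Ico, Set.mem_Iio, Set.mem_Ici]
  split_ifs <;> first | lia | simp

/-- A far term is small on any given initial segment because its coordinates tend to zero, and small
on a remote tail because each vector has vanishing tails. -/
theorem exists_gliding_hump {d : ℕ → GarlingF 𝕜 hw hp}
    (hd : ∀ j, Tendsto (fun n => coords (d n) j) atTop (𝓝 0)) {δ : ℝ} (hδ : 0 < δ) :
    ∃ k t : ℕ → ℕ, StrictMono k ∧ StrictMono t ∧ ∀ i,
      ‖d (k i) - restrict (Set.Ico (t i) (t (i + 1))) (d (k i))‖ ≤ δ * (1 / 2) ^ i := by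
  have step : ∀ i κ s : ℕ, ∃ k s', κ ≤ k ∧ s < s' ∧
      ‖d k - restrict (Set.Ico s s') (d k)‖ ≤ δ * (1 / 2) ^ i := by
    intro i κ s
    have hη : 0 < δ * (1 / 2 : ℝ) ^ i / 2 := by positivity
    obtain ⟨k, hk, hκ⟩ := (((tendsto_norm_restrict_Iio hd s).eventually_lt_const hη).and
      (eventually_ge_atTop κ)).exists
    obtain ⟨N, hN⟩ := exists_norm_restrict_Ici_le (d k) hη
    refine ⟨k, max N (s + 1), hκ, by lia, ?_⟩
    rw [sub_restrict_Ico _ (by lia)]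
    have h1 := norm_add_le (restrict (Set.Iio s) (d k)) (restrict (Set.Ici (max N (s + 1))) (d k))
    have h2 := norm_restrict_mono (Set.Ici_subset_Ici.2 (le_max_left N (s + 1))) (d k)
    linarith
  choose k s hκ hs hks using step
  -- The state records the least admissible next index and the left end of the next block.
  let st : ℕ → ℕ × ℕ := fun n => Nat.rec (0, 0)
    (fun i q => (k i q.1 q.2 + 1, s i q.1 q.2)) n
  have hst : ∀ i, st (i + 1) = (k i (st i).1 (st i).2 + 1, s i (st i).1 (st i).2) := fun i => rfl
  refine ⟨fun i => k i (st i).1 (st i).2, fun i => (st i).2, strictMono_nat_of_lt_succ fun i => ?_,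
    strictMono_nat_of_lt_succ fun i => ?_, fun i => ?_⟩
  · refine lt_of_lt_of_le ?_ (hκ (i + 1) _ _)
    rw [hst]
    exact Nat.lt_succ_self _
  · rw [hst]
    exact hs i _ _
  · have := hks i (st i).1 (st i).2
    dsimp only
    rwa [hst]

/-- y_m is a partial sum of the expansion of y_m - y_n, so the basis constant bounds it; K + 1
replaces K to be positive. -/
theorem exists_le_norm_sub {y : ℕ → GarlingF 𝕜 hw hp} (hy : IsSubsymmetricBasicSequence 𝕜 y) :
    ∃ c > 0, ∀ m n, m < n → c ≤ ‖y m - y n‖ := by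
  obtain ⟨c, hc, hyc⟩ := hy.exists_le_norm (min_one_pos hp) norm_smul_eq
  obtain ⟨K, hK, hyK⟩ := hy.basic.exists_basis_constant (min_one_pos hp) norm_smul_eq
  refine ⟨c / (K + 1), by positivity, fun m n hmn => ?_⟩
  have h1 : HasSum (fun i => (Pi.single m 1 - Pi.single n 1 : ℕ → 𝕜) i • y i) (y m - y n) := by
    have h2 : ∀ m, HasSum (fun i => (Pi.single m 1 : ℕ → 𝕜) i • y i) (y m) := fun m => by
      have := hasSum_single (f := fun i => (Pi.single m 1 : ℕ → 𝕜) i • y i) m fun i hi => by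
        rw [Pi.single_eq_of_ne hi, zero_smul]
      simpa using this
    simpa only [Pi.sub_apply, sub_smul] using (h2 m).sub (h2 n)
  have h3 := hyK _ _ h1.seriesConvergesTo (m + 1)
  have h4 : ∑ i ∈ Finset.range (m + 1), (Pi.single m 1 - Pi.single n 1 : ℕ → 𝕜) i • y i = y m := by
    rw [Finset.sum_eq_single_of_mem m (by simp) fun i hi him => ?_]
    · simp [Pi.single_eq_of_ne hmn.ne]
    · have hin : i ≠ n := by
        have := Finset.mem_range.1 hi
        lia
      simp [Pi.single_eq_of_ne him, Pi.single_eq_of_ne hin]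
  rw [h4] at h3
  rw [div_le_iff₀ (by positivity)]
  have := hyc m
  have := norm_nonneg (y m - y n)
  linarith

/-- The differences of a subsequence are small perturbations of a semi-normalized block sequence
of the unit vector system. -/
theorem exists_block_sequence {y : ℕ → GarlingF 𝕜 hw hp}
    (hy : IsSubsymmetricBasicSequence 𝕜 y) :
    ∃ (σ : ℕ → ℕ) (x : ℕ → GarlingF 𝕜 hw hp) (t : ℕ → ℕ), StrictMono σ ∧ StrictMono t ∧
      (∀ k j, coords (x k) j ≠ 0 → t k ≤ j ∧ j < t (k + 1)) ∧
      (Summable fun n => ‖y (σ (2 * n)) - y (σ (2 * n + 1)) - x n‖) ∧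
      ∃ c C, 0 < c ∧ ∀ n, c ≤ modulus (x n) ∧ modulus (x n) ≤ C := by
  obtain ⟨D, hD⟩ := hy.exists_norm_le (min_one_pos hp) norm_smul_eq
  obtain ⟨c, hc, hyc⟩ := exists_le_norm_sub hy
  obtain ⟨φ, l, hφ, hl⟩ := exists_subseq_tendsto_coords hD
  have hd : ∀ j, Tendsto (fun n => coords (y (φ (2 * n)) - y (φ (2 * n + 1))) j) atTop (𝓝 0) := by
    intro j
    have h0 : Tendsto (fun n : ℕ => 2 * n) atTop atTop :=
      tendsto_atTop_atTop.2 fun b => ⟨b, fun n hn => by lia⟩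
    have h1 := ((hl j).comp h0).sub ((hl j).comp ((tendsto_add_atTop_nat 1).comp h0))
    simpa using h1
  -- The differences have norm at least c, so an error of at most c/2 leaves blocks of norm at least
  -- c/2.
  obtain ⟨k, t, hk, ht, hkt⟩ := exists_gliding_hump hd (half_pos hc)
  set x : ℕ → GarlingF 𝕜 hw hp := fun i => restrict (Set.Ico (t i) (t (i + 1)))
    (y (φ (2 * k i)) - y (φ (2 * k i + 1)))
  have hnorm : ∀ i, c / 2 ≤ ‖x i‖ ∧ ‖x i‖ ≤ 2 * D := by
    intro i
    have h1 := hkt i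
    have h2 := hyc _ _ (hφ (Nat.lt_succ_self (2 * k i)))
    have h3 : (1 / 2 : ℝ) ^ i ≤ 1 := pow_le_one₀ (by norm_num) (by norm_num)
    have h4 := norm_sub_norm_le (y (φ (2 * k i)) - y (φ (2 * k i + 1))) (x i)
    have h5 := norm_sub_le (y (φ (2 * k i))) (y (φ (2 * k i + 1)))
    have h6 := hD (φ (2 * k i))
    have h7 := hD (φ (2 * k i + 1))
    have h8 : ‖x i‖ ≤ ‖y (φ (2 * k i)) - y (φ (2 * k i + 1))‖ := norm_mono fun j => by
      rw [coords_restrict]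
      exact norm_indicator_le_norm_self _ _
    have h9 : c / 2 * (1 / 2 : ℝ) ^ i ≤ c / 2 := mul_le_of_le_one_right (half_pos hc).le h3
    simp only [Nat.succ_eq_add_one] at h2
    constructor <;> linarith
  have hq := (div_pos hp (min_one_pos hp)).le
  refine ⟨fun n => φ (pairIndex k n), x, t, hφ.comp hk.pairIndex, ht, fun i j hij => ?_, ?_,
    (c / 2) ^ (p / min 1 p), (2 * D) ^ (p / min 1 p), by positivity, fun n => ?_⟩
  · rw [coords_restrict] at hij
    exact Set.mem_Ico.1 (Set.mem_of_indicator_ne_zero hij)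
  · simp only [pairIndex_even, pairIndex_odd]
    exact (summable_geometric_two.mul_left (c / 2)).of_nonneg_of_le (fun _ => norm_nonneg _) hkt
  · rw [modulus_eq]
    exact ⟨Real.rpow_le_rpow (half_pos hc).le (hnorm n).1 hq,
      Real.rpow_le_rpow (norm_nonneg _) (hnorm n).2 hq⟩

theorem eq_of_coords_ne_zero {x : ℕ → GarlingF 𝕜 hw hp} {t : ℕ → ℕ} (ht : Monotone t)
    (hx : ∀ k j, coords (x k) j ≠ 0 → t k ≤ j ∧ j < t (k + 1)) (i k l : ℕ)
    (hk : coords (x k) i ≠ 0) (hl : coords (x l) i ≠ 0) : k = l := by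
  have h1 := hx k i hk
  have h2 := hx l i hl
  by_contra h
  rcases lt_or_gt_of_ne h with h | h
  · have := ht (Nat.succ_le_of_lt h)
    simp only [Nat.succ_eq_add_one] at this
    lia
  · have := ht (Nat.succ_le_of_lt h)
    simp only [Nat.succ_eq_add_one] at this
    lia

/-- If the shifted sums of the blocks do not vanish uniformly, then the sequence is equivalent to
the unit vector system of `ℓ_p`. -/
theorem equivalentSequences_lpUnitVectors {y : ℕ → GarlingF 𝕜 hw hp}
    (hy : IsSubsymmetricBasicSequence 𝕜 y) {σ : ℕ → ℕ} (hσ : StrictMono σ)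
    {x : ℕ → GarlingF 𝕜 hw hp} {t : ℕ → ℕ} (ht : Monotone t)
    (hx : ∀ k j, coords (x k) j ≠ 0 → t k ≤ j ∧ j < t (k + 1))
    (hdx : Summable fun n => ‖y (σ (2 * n)) - y (σ (2 * n + 1)) - x n‖) {C : ℝ}
    (hxC : ∀ k, modulus (x k) ≤ C) {c : ℝ} (hc : 0 < c)
    (hS : ∀ J K, ∃ k ≥ K, ∃ S, c < shiftedSum w p J S (coords (x k))) :
    EquivalentSequences 𝕜 y (lpUnitVectors 𝕜 p) := by
  -- The shift `t K` is the left end of the interval allotted to the selected block; the next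
  -- interval begins right after that block.
  choose g hg hgS using fun K => hS (t K) K
  let κ : ℕ → ℕ := fun n => Nat.rec 0 (fun _ K => g K + 1) n
  have hκ : ∀ n, κ (n + 1) = g (κ n) + 1 := fun n => rfl
  have hκmono : StrictMono κ := strictMono_nat_of_lt_succ fun n => by
    rw [hκ]
    exact Nat.lt_succ_of_le (hg _)
  have hψ : StrictMono fun n => g (κ n) := strictMono_nat_of_lt_succ fun n => by
    refine lt_of_lt_of_le ?_ (hg _)
    rw [hκ]
    exact Nat.lt_succ_self _
  have hdx' : Summable fun n => ‖y (σ (pairIndex (fun n => g (κ n)) (2 * n)))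
      - y (σ (pairIndex (fun n => g (κ n)) (2 * n + 1))) - x (g (κ n))‖ := by
    simp only [pairIndex_even, pairIndex_odd]
    exact hdx.comp_injective hψ.injective
  intro a
  rw [exists_seriesConvergesTo_lpUnitVectors_iff hp]
  constructor
  · refine summable_rpow_of_seriesConvergesTo (x := fun n => x (g (κ n))) hy
      (hσ.comp hψ.pairIndex) hdx' (ht.comp hκmono.monotone)
      (fun k j hj => ?_) hc fun k => hgS (κ k)
    have h1 := hx _ j hj
    simp only [Function.comp_apply, hκ]
    exact ⟨(ht (hg _)).trans h1.1, h1.2⟩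
  · exact exists_seriesConvergesTo_of_summable_rpow (x := fun n => x (g (κ n))) hy
      (hσ.comp hψ.pairIndex) hdx' (fun i k l hk hl => hψ.injective
        (eq_of_coords_ne_zero ht hx i _ _ hk hl)) fun k => hxC _

end GarlingF

/-! ### Normalized sums of many blocks -/

namespace GarlingF

variable {𝕜 : Type*} [RCLike 𝕜] {w : ℕ → ℝ} {p : ℝ} {hw : IsGarlingWeight w} {hp : 0 < p}

theorem coords_sum_eq {x : ℕ → GarlingF 𝕜 hw hp}
    (hx : ∀ i k l, coords (x k) i ≠ 0 → coords (x l) i ≠ 0 → k = l) (A : Finset ℕ) {k : ℕ}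
    (hk : k ∈ A) {i : ℕ} (hki : coords (x k) i ≠ 0) :
    coords (∑ l ∈ A, x l) i = coords (x k) i := by
  rw [map_sum, Finset.sum_apply]
  refine Finset.sum_eq_single_of_mem k hk fun l _ hlk => ?_
  by_contra h
  exact hlk (hx i l k h hki)

theorem exists_coords_ne_zero_of_sum {x : ℕ → GarlingF 𝕜 hw hp} {A : Finset ℕ} {i : ℕ}
    (h : coords (∑ l ∈ A, x l) i ≠ 0) : ∃ k ∈ A, coords (x k) i ≠ 0 := by
  rw [map_sum, Finset.sum_apply] at h
  exact Finset.exists_ne_zero_of_sum_ne_zero h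

theorem norm_coords_sum_rpow_le {x : ℕ → GarlingF 𝕜 hw hp}
    (hx : ∀ i k l, coords (x k) i ≠ 0 → coords (x l) i ≠ 0 → k = l) {C : ℝ}
    (hC : ∀ k, modulus (x k) ≤ C) (A : Finset ℕ) (i : ℕ) :
    ‖coords (∑ l ∈ A, x l) i‖ ^ p ≤ C := by
  rcases eq_or_ne (coords (∑ l ∈ A, x l) i) 0 with h | h
  · rw [h, norm_zero, Real.zero_rpow hp.ne']
    exact (modulus_nonneg _).trans (hC 0)
  · obtain ⟨k, hk, hki⟩ := exists_coords_ne_zero_of_sum h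
    rw [coords_sum_eq hx A hk hki]
    exact (norm_coords_rpow_le _ i).trans (hC k)

/-- A block all of whose entries are below the threshold would lose at most c/4 under the shift J,
and what remains after the shift is at most c/4, against a modulus of at least c. -/
theorem exists_le_norm_coords {x : ℕ → GarlingF 𝕜 hw hp} {c : ℝ} (hc : 0 < c)
    (hxc : ∀ k, c ≤ modulus (x k))
    (hvan : ∀ ε > 0, ∃ J K, ∀ k ≥ K, ∀ S, shiftedSum w p J S (coords (x k)) ≤ ε) :
    ∃ τ > 0, ∃ K, ∀ k ≥ K, ∃ i, τ ≤ ‖coords (x k) i‖ ^ p := by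
  obtain ⟨J, K, hJ⟩ := hvan (c / 4) (by positivity)
  refine ⟨c / (4 * (J + 1)), by positivity, K, fun k hk => ?_⟩
  by_contra! H
  obtain ⟨S, hS⟩ := exists_shiftedSum_gt ((half_lt_self hc).trans_le (hxc k))
  have h1 := shiftedSum_zero_le_add (p := p) hw J S (coords (x k))
    (show 0 ≤ c / (4 * (J + 1)) by positivity) fun i _ => (H i).le
  have h2 := hJ k hk S
  have h3 : c / (4 * (J + 1)) * J ≤ c / 4 := by
    rw [div_mul_eq_mul_div, div_le_div_iff₀ (by positivity) (by positivity)]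
    nlinarith
  linarith

/-- Taking one large coordinate from each block gives `A.card` distinct indices. -/
theorem mul_sum_range_le_modulus_sum {x : ℕ → GarlingF 𝕜 hw hp}
    (hx : ∀ i k l, coords (x k) i ≠ 0 → coords (x l) i ≠ 0 → k = l) {τ : ℝ} (hτ : 0 < τ)
    {A : Finset ℕ} (hA : ∀ k ∈ A, ∃ i, τ ≤ ‖coords (x k) i‖ ^ p) :
    τ * ∑ j ∈ Finset.range A.card, w j ≤ modulus (∑ k ∈ A, x k) := by
  choose! f hf using hA
  have hne : ∀ k ∈ A, coords (x k) (f k) ≠ 0 := fun k hk h => by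
    have h1 := hf k hk
    rw [h, norm_zero, Real.zero_rpow hp.ne'] at h1
    exact h1.not_gt hτ
  have hinj : Set.InjOn f A := fun k hk l hl hkl =>
    hx (f k) k l (hne k hk) (hkl ▸ hne l hl)
  rw [← Finset.card_image_of_injOn hinj]
  refine (mul_sum_range_le_shiftedSum hw _ _ fun i hi => ?_).trans (shiftedSum_le_modulus _ _)
  obtain ⟨k, hk, rfl⟩ := Finset.mem_image.1 hi
  rw [coords_sum_eq hx A hk (hne k hk)]
  exact hf k hk

/-- The vector `v` comes after the vector `u`, which is flat compared to the rate of decay of the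
shifted sums of `v`. -/
theorem modulus_add_le_of_flat {u v : GarlingF 𝕜 hw hp} {b J : ℕ} {ε η M : ℝ}
    (hu : ∀ i, coords u i ≠ 0 → i < b) (hv : ∀ i, coords v i ≠ 0 → b ≤ i)
    (hu1 : modulus u ≤ M) (hvM : modulus v ≤ M) (hη : ∀ i, ‖coords u i‖ ^ p ≤ η)
    (hηε : J * η ≤ ε) (hvJ : ∀ S, shiftedSum w p J S (coords v) ≤ ε) :
    modulus (u + v) ≤ M + ε := by
  refine modulus_le fun S => ?_
  have hη0 : 0 ≤ η := (Real.rpow_nonneg (norm_nonneg _) _).trans (hη 0)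
  have hS : S = S.filter (· < b) ∪ S.filter (b ≤ ·) := by
    ext i
    simp only [Finset.mem_union, Finset.mem_filter]
    have := lt_or_ge i b
    tauto
  rw [hS, shiftedSum_union 0 fun i hi j hj =>
    (Finset.mem_filter.1 hi).2.trans_le (Finset.mem_filter.1 hj).2, zero_add]
  rw [shiftedSum_congr (S := S.filter (· < b)) (y := coords u) _ fun i hi => ?_,
    shiftedSum_congr (S := S.filter (b ≤ ·)) (y := coords v) _ fun i hi => ?_]
  · rcases le_total J (S.filter (· < b)).card with h | h
    · exact add_le_add ((shiftedSum_le_modulus _ u).trans hu1)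
        ((shiftedSum_anti hw h _ _).trans (hvJ _))
    · rw [add_comm M]
      refine add_le_add ((shiftedSum_le_card_mul hw 0 _ _ fun i _ => hη i).trans
        (le_trans ?_ hηε)) ?_
      · exact mul_le_mul_of_nonneg_right (Nat.cast_le.2 h) hη0
      · exact (shiftedSum_anti hw (Nat.zero_le _) _ _).trans
          ((shiftedSum_le_modulus _ v).trans hvM)
  · rw [map_add, Pi.add_apply, not_not.1 fun h => (hu i h).not_ge (Finset.mem_filter.1 hi).2,
      zero_add]
  · rw [map_add, Pi.add_apply, not_not.1 fun h => (Finset.mem_filter.1 hi).2.not_ge (hv i h),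
      add_zero]

/-- Sums over successive long sets of blocks, the first ones much longer than the later ones,
behave like the unit vector basis of `ℓ_∞ⁿ` once they are normalized. -/
theorem exists_sizes_modulus_sum_le {x : ℕ → GarlingF 𝕜 hw hp} {t : ℕ → ℕ} (ht : Monotone t)
    (hx : ∀ k j, coords (x k) j ≠ 0 → t k ≤ j ∧ j < t (k + 1)) {c C : ℝ} (hc : 0 < c)
    (hxc : ∀ k, c ≤ modulus (x k)) (hxC : ∀ k, modulus (x k) ≤ C)
    (hvan : ∀ ε > 0, ∃ J K, ∀ k ≥ K, ∀ S, shiftedSum w p J S (coords (x k)) ≤ ε)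
    {s : Finset ℕ → 𝕜} (hs : ∀ A, ‖s A‖ ^ p = (modulus (∑ k ∈ A, x k))⁻¹) (n : ℕ) :
    ∀ ε > 0, ∃ m : Fin n → ℕ, (∀ i, 0 < m i) ∧ ∃ K, ∀ A : Fin n → Finset ℕ,
      (∀ i, (A i).card = m i) → (∀ i, ∀ k ∈ A i, K ≤ k) →
      (∀ i j, i < j → ∀ k ∈ A i, ∀ l ∈ A j, k < l) → ∀ a : Fin n → 𝕜, (∀ i, ‖a i‖ ≤ 1) →
      modulus (∑ i, a i • s (A i) • ∑ k ∈ A i, x k) ≤ 1 + ε := by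
  have hdisj := eq_of_coords_ne_zero ht hx
  obtain ⟨τ, hτ, K₀, hK₀⟩ := exists_le_norm_coords hc hxc hvan
  have hmod : ∀ A : Finset ℕ, A.Nonempty → c ≤ modulus (∑ k ∈ A, x k) := fun A ⟨k, hk⟩ =>
    (hxc k).trans (modulus_le_modulus_sum A x (fun i k _ l _ => hdisj i k l) hk)
  have hsle : ∀ A : Finset ℕ, A.Nonempty → ‖s A‖ ^ p ≤ c⁻¹ := fun A hA => by
    rw [hs]
    exact inv_anti₀ hc (hmod A hA)
  have hle1 : ∀ a : 𝕜, ‖a‖ ≤ 1 → ‖a‖ ^ p ≤ 1 := fun a ha =>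
    Real.rpow_le_one (norm_nonneg _) ha hp.le
  have hsupp : ∀ (a : 𝕜) (A : Finset ℕ) (i : ℕ), coords (a • s A • ∑ k ∈ A, x k) i ≠ 0 →
      ∃ k ∈ A, coords (x k) i ≠ 0 := fun a A i h => by
    rw [map_smul, map_smul, Pi.smul_apply, Pi.smul_apply] at h
    exact exists_coords_ne_zero_of_sum (right_ne_zero_of_smul (right_ne_zero_of_smul h))
  induction n with
  | zero =>
    intro ε hε
    refine ⟨Fin.elim0, fun i => i.elim0, 0, fun A _ _ _ a _ => ?_⟩
    rw [Finset.univ_eq_empty, Finset.sum_empty, modulus_zero]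
    linarith
  | succ n ih =>
    intro ε hε
    -- The later lengths come first: the new set is placed in front, and its length depends on them
    -- through J.
    obtain ⟨m, hm, K, hK⟩ := ih (ε / 2) (half_pos hε)
    set M : ℝ := ∑ i, (m i : ℝ)
    have hM : 0 ≤ M := Finset.sum_nonneg fun i _ => Nat.cast_nonneg _
    -- M counts the blocks in all later sets and 1/c bounds the p-th powers of the normalizing
    -- scalars, so beyond the shift J the later vectors contribute at most ε/2 in total.
    obtain ⟨J, K', hJ⟩ := hvan (ε * c / (2 * (M + 1))) (by positivity)
    -- With this length the p-th powers of the entries of the normalized first vector, bounded by C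
    -- over τ times the sum of weights, are at most ε/2 after multiplication by J.
    obtain ⟨m₀, hm₀, hm₀'⟩ := ((hw.tendsto_sum.eventually_ge_atTop (2 * (J * C) / (ε * τ))).and
      (eventually_gt_atTop 0)).exists
    refine ⟨Fin.cons m₀ m, fun i => ?_, max K₀ (max K K'), fun A hAm hAK hAlt a ha => ?_⟩
    · refine Fin.cases ?_ (fun i => ?_) i
      · exact hm₀'
      · exact hm i
    have hA0 : (A 0).card = m₀ := hAm 0
    have hAs : ∀ i : Fin n, (A i.succ).card = m i := fun i => hAm i.succ
    have hne0 : (A 0).Nonempty := Finset.card_pos.1 (by lia)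
    have hnes : ∀ i : Fin n, (A i.succ).Nonempty := fun i =>
      Finset.card_pos.1 (by rw [hAs]; exact hm i)
    have hAK' : ∀ i, ∀ k ∈ A i, K₀ ≤ k ∧ K ≤ k ∧ K' ≤ k := fun i k hk => by
      have := hAK i k hk
      lia
    rw [Fin.sum_univ_succ]
    have hW : 0 < ∑ j ∈ Finset.range m₀, w j :=
      Finset.sum_pos (fun j _ => hw.pos j) ⟨0, Finset.mem_range.2 hm₀'⟩
    have hmod0 := mul_sum_range_le_modulus_sum hdisj hτ (A := A 0)
      fun k hk => hK₀ k (hAK' 0 k hk).1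
    rw [hA0] at hmod0
    have hC0 : 0 ≤ C := (modulus_nonneg _).trans (hxC 0)
    rw [show 1 + ε = 1 + ε / 2 + ε / 2 by ring]
    refine modulus_add_le_of_flat (b := t ((A 0).max' hne0 + 1)) (J := J)
      (η := C / (τ * ∑ j ∈ Finset.range m₀, w j)) (fun i hi => ?_) (fun i hi => ?_) ?_
      (hK _ hAs (fun i k hk => (hAK' _ k hk).2.1)
        (fun i j hij => hAlt _ _ (Fin.succ_lt_succ_iff.2 hij)) _ fun i => ha _)
      (fun i => ?_) ?_ (fun S => ?_)
    · obtain ⟨k, hk, hki⟩ := hsupp _ _ i hi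
      exact (hx k i hki).2.trans_le (ht (Nat.succ_le_succ (Finset.le_max' _ k hk)))
    · rw [map_sum, Finset.sum_apply] at hi
      obtain ⟨j, -, hj⟩ := Finset.exists_ne_zero_of_sum_ne_zero hi
      obtain ⟨k, hk, hki⟩ := hsupp _ _ i hj
      exact (ht (Nat.succ_le_of_lt (hAlt 0 _ (Fin.succ_pos j) _ (Finset.max'_mem _ hne0) k hk))).trans
        (hx k i hki).1
    · rw [modulus_smul, modulus_smul, hs, inv_mul_cancel₀ (hc.trans_le (hmod _ hne0)).ne', mul_one]
      linarith [hle1 _ (ha 0)]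
    · rw [map_smul, map_smul, Pi.smul_apply, Pi.smul_apply, smul_eq_mul, smul_eq_mul, norm_mul,
        norm_mul, Real.mul_rpow (norm_nonneg _) (by positivity),
        Real.mul_rpow (norm_nonneg _) (norm_nonneg _), hs]
      refine (mul_le_of_le_one_left (by have := modulus_nonneg (∑ k ∈ A 0, x k); positivity)
        (hle1 _ (ha 0))).trans ?_
      rw [inv_mul_eq_div]
      exact div_le_div₀ hC0 (norm_coords_sum_rpow_le hdisj hxC _ i) (by positivity) hmod0
    · rw [div_le_iff₀ (by positivity)] at hm₀
      rw [← mul_div_assoc, div_le_iff₀ (by positivity)]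
      linarith
    · refine (shiftedSum_sum_le J S _ _ fun i j _ l _ hj hl => ?_).trans ?_
      · obtain ⟨k, hk, hki⟩ := hsupp _ _ i hj
        obtain ⟨k', hk', hki'⟩ := hsupp _ _ i hl
        have hkk := hdisj i k k' hki hki'
        rcases lt_trichotomy j l with h | h | h
        · have := hAlt _ _ (Fin.succ_lt_succ_iff.2 h) k hk k' hk'
          lia
        · exact h
        · have := hAlt _ _ (Fin.succ_lt_succ_iff.2 h) k' hk' k hk
          lia
      · have h1 : ∀ i : Fin n, shiftedSum w p J S
            (coords (a i.succ • s (A i.succ) • ∑ k ∈ A i.succ, x k))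
            ≤ m i * (ε / (2 * (M + 1))) := by
          intro i
          rw [map_smul, map_smul, shiftedSum_smul, shiftedSum_smul]
          have h2 : shiftedSum w p J S (coords (∑ k ∈ A i.succ, x k))
              ≤ m i * (ε * c / (2 * (M + 1))) := by
            refine (shiftedSum_sum_le J S _ _ fun i k _ l _ => hdisj i k l).trans ?_
            rw [← hAs i, ← nsmul_eq_mul]
            exact Finset.sum_le_card_nsmul _ _ _ fun k hk => hJ k (hAK' _ k hk).2.2 S
          have h3 := shiftedSum_nonneg (p := p) hw J S (coords (∑ k ∈ A i.succ, x k))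
          refine (mul_le_of_le_one_left (by positivity) (hle1 _ (ha _))).trans ?_
          refine (mul_le_mul (hsle _ (hnes i)) h2 h3 (by positivity)).trans_eq ?_
          field_simp
        refine (Finset.sum_le_sum fun i _ => h1 i).trans ?_
        rw [← Finset.sum_mul, mul_div_assoc', div_le_div_iff₀ (by positivity) (by positivity)]
        nlinarith

end GarlingF

/-! ### Perturbation and almost isometric copies of ℓ_∞^n -/

namespace GarlingF

variable {𝕜 : Type*} [RCLike 𝕜] {w : ℕ → ℝ} {p : ℝ} {hw : IsGarlingWeight w} {hp : 0 < p}

/-- Supports are disjoint and the modulus is monotone in the absolute values of the coordinates, so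
each summand is dominated by the sum. -/
theorem norm_rpow_le_norm_sum {n : ℕ} {u : Fin n → GarlingF 𝕜 hw hp}
    (hu : ∀ i j k, coords (u j) i ≠ 0 → coords (u k) i ≠ 0 → j = k)
    (hu1 : ∀ j, modulus (u j) = 1) (a : Fin n → 𝕜) :
    ‖a‖ ^ min 1 p ≤ ‖∑ j, a j • u j‖ := by
  rw [← Real.le_rpow_inv_iff_of_pos (norm_nonneg _) (norm_nonneg _) (min_one_pos hp),
    pi_norm_le_iff_of_nonneg (by positivity)]
  intro j
  have hsupp : ∀ i k, coords (a k • u k) i ≠ 0 → coords (u k) i ≠ 0 := fun i k h => by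
    rw [map_smul, Pi.smul_apply] at h
    exact right_ne_zero_of_smul h
  have h1 := modulus_le_modulus_sum Finset.univ (fun j => a j • u j)
    (fun i k _ l _ hk hl => hu i k l (hsupp i k hk) (hsupp i l hl)) (Finset.mem_univ j)
  rw [modulus_smul, hu1, mul_one, modulus_eq, ← Real.le_rpow_inv_iff_of_pos (norm_nonneg _)
    (by positivity) hp, ← Real.rpow_mul (norm_nonneg _)] at h1
  refine h1.trans_eq ?_
  congr 1
  have := (min_one_pos hp).ne'
  field_simp

theorem exists_successive_finsets {n : ℕ} (m : Fin n → ℕ) (K : ℕ) :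
    ∃ A : Fin n → Finset ℕ, (∀ i, (A i).card = m i) ∧ (∀ i, ∀ k ∈ A i, K ≤ k) ∧
      ∀ i j, i < j → ∀ k ∈ A i, ∀ l ∈ A j, k < l := by
  set M := ∑ i, m i
  have hM : ∀ i, m i ≤ M := fun i => Finset.single_le_sum (fun _ _ => Nat.zero_le _)
    (Finset.mem_univ i)
  refine ⟨fun i => Finset.Ico (K + i * M) (K + i * M + m i), fun i => by simp, fun i k hk => ?_,
    fun i j hij k hk l hl => ?_⟩
  · exact (Nat.le_add_right _ _).trans (Finset.mem_Ico.1 hk).1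
  · have h1 := (Finset.mem_Ico.1 hk).2
    have h2 := (Finset.mem_Ico.1 hl).1
    have h3 : ((i : ℕ) + 1) * M ≤ j * M := Nat.mul_le_mul_right M hij
    have h4 := hM i
    lia

theorem exists_tail_sum_le {e : ℕ → ℝ} (he : Summable e) {δ : ℝ} (hδ : 0 < δ) :
    ∃ K, ∀ A : Finset ℕ, (∀ k ∈ A, K ≤ k) → ∑ k ∈ A, e k ≤ δ := by
  obtain ⟨s, hs⟩ := summable_iff_vanishing_norm.1 he δ hδ
  refine ⟨s.sup id + 1, fun A hA => (le_abs_self _).trans (hs A ?_).le⟩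
  refine Finset.disjoint_left.2 fun k hk hks => ?_
  have h1 := hA k hk
  have h2 : k ≤ s.sup id := Finset.le_sup (f := id) hks
  lia

/-- Perturbations of normalized sums of blocks still span almost isometric copies of `ℓ_∞ⁿ`. -/
theorem exists_almost_isometric {x d : ℕ → GarlingF 𝕜 hw hp} {t : ℕ → ℕ} (ht : Monotone t)
    (hx : ∀ k j, coords (x k) j ≠ 0 → t k ≤ j ∧ j < t (k + 1)) {c C : ℝ} (hc : 0 < c)
    (hxc : ∀ k, c ≤ modulus (x k)) (hxC : ∀ k, modulus (x k) ≤ C)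
    (hvan : ∀ ε > 0, ∃ J K, ∀ k ≥ K, ∀ S, shiftedSum w p J S (coords (x k)) ≤ ε)
    (hdx : Summable fun k => ‖d k - x k‖) (n : ℕ) {ε : ℝ} (hε : 0 < ε) :
    ∃ (A : Fin n → Finset ℕ) (s : Fin n → 𝕜),
      (∀ i j, i < j → ∀ k ∈ A i, ∀ l ∈ A j, k < l) ∧ ∀ a : Fin n → 𝕜,
        ‖a‖ ^ min 1 p ≤ ‖∑ i, a i • s i • ∑ k ∈ A i, d k‖ ∧
        ‖∑ i, a i • s i • ∑ k ∈ A i, d k‖ ≤ ((1 + ε) * ‖a‖) ^ min 1 p := by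
  have hr := min_one_pos hp
  have hdisj := eq_of_coords_ne_zero ht hx
  obtain ⟨θ, hθ⟩ : ∃ θ, θ = (1 + ε) ^ min 1 p := ⟨_, rfl⟩
  have hθ1 : 1 < θ := hθ ▸ Real.one_lt_rpow (by linarith) hr
  -- δ solves (1 + θ)/2 + δ = θ(1 - δ): block sums of F-norm between 1 and (1 + θ)/2, perturbed by
  -- δ, lie between 1 - δ and θ(1 - δ).
  obtain ⟨δ, hδ⟩ : ∃ δ, δ = (θ - 1) / (2 * (1 + θ)) := ⟨_, rfl⟩
  have hδ0 : 0 < δ := hδ ▸ div_pos (by linarith) (by linarith)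
  have hδ1 : δ < 1 := by
    rw [hδ, div_lt_one (by linarith)]
    linarith
  have hδθ : (1 + θ) / 2 + δ = θ * (1 - δ) := by
    rw [hδ]
    field_simp
    ring
  have hq : 0 < p / min 1 p := div_pos hp hr
  choose s hs using fun A : Finset ℕ => exists_norm_rpow_eq 𝕜 hp
    (inv_nonneg.2 (modulus_nonneg (∑ k ∈ A, x k)))
  -- The tolerance is chosen so that the modulus bound becomes the bound (1 + θ)/2 on the F-norm.
  obtain ⟨m, hm, K, hK⟩ := exists_sizes_modulus_sum_le ht hx hc hxc hxC hvan hs n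
    (((1 + θ) / 2) ^ (p / min 1 p) - 1)
    (sub_pos.2 (Real.one_lt_rpow (by linarith) hq))
  obtain ⟨Λ, hΛ⟩ : ∃ Λ, Λ = c⁻¹ ^ (min 1 p / p) := ⟨_, rfl⟩
  have hΛ0 : 0 < Λ := hΛ ▸ Real.rpow_pos_of_pos (inv_pos.2 hc) _
  obtain ⟨K', hK'⟩ := exists_tail_sum_le hdx (show 0 < δ / ((n + 1) * Λ) by positivity)
  obtain ⟨A, hAm, hAK, hAlt⟩ := exists_successive_finsets m (max K K')
  have hmod : ∀ i, c ≤ modulus (∑ k ∈ A i, x k) := fun i => by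
    obtain ⟨k, hk⟩ : (A i).Nonempty := Finset.card_pos.1 (by rw [hAm]; exact hm i)
    exact (hxc k).trans (modulus_le_modulus_sum (A i) x (fun i k _ l _ => hdisj i k l) hk)
  have hsΛ : ∀ i, ‖s (A i)‖ ^ min 1 p ≤ Λ := fun i => by
    have h1 : ‖s (A i)‖ ^ p ≤ c⁻¹ := by
      rw [hs]
      exact inv_anti₀ hc (hmod i)
    have h2 := Real.rpow_le_rpow (by positivity) h1 (min_div_pos hp).le
    rwa [← Real.rpow_mul (norm_nonneg _), mul_div_cancel₀ _ hp.ne', ← hΛ] at h2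
  have hunit : ∀ i, modulus (s (A i) • ∑ k ∈ A i, x k) = 1 := fun i => by
    rw [modulus_smul, hs, inv_mul_cancel₀ (hc.trans_le (hmod i)).ne']
  have hdisjA : ∀ i j k, coords (s (A j) • ∑ l ∈ A j, x l) i ≠ 0 →
      coords (s (A k) • ∑ l ∈ A k, x l) i ≠ 0 → j = k := fun i j k hj hk => by
    rw [map_smul, Pi.smul_apply] at hj hk
    obtain ⟨l, hl, hli⟩ := exists_coords_ne_zero_of_sum (right_ne_zero_of_smul hj)
    obtain ⟨l', hl', hli'⟩ := exists_coords_ne_zero_of_sum (right_ne_zero_of_smul hk)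
    have hll := hdisj i l l' hli hli'
    rcases lt_trichotomy j k with h | h | h
    · have := hAlt _ _ h l hl l' hl'
      lia
    · exact h
    · have := hAlt _ _ h l' hl' l hl
      lia
  have hpert : ∀ a : Fin n → 𝕜, ‖a‖ = 1 →
      ‖∑ i, a i • s (A i) • ∑ k ∈ A i, d k - ∑ i, a i • s (A i) • ∑ k ∈ A i, x k‖ ≤ δ := by
    intro a ha
    rw [← Finset.sum_sub_distrib]
    have h1 : ∀ i ∈ (Finset.univ : Finset (Fin n)), ‖a i • s (A i) • ∑ k ∈ A i, d k
        - a i • s (A i) • ∑ k ∈ A i, x k‖ ≤ δ / (n + 1) := by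
      intro i _
      rw [← smul_sub, ← smul_sub, ← Finset.sum_sub_distrib, norm_smul_eq, norm_smul_eq]
      have h2 : ‖a i‖ ^ min 1 p ≤ 1 :=
        Real.rpow_le_one (norm_nonneg _) ((norm_le_pi_norm a i).trans ha.le) hr.le
      have h3 : ‖∑ k ∈ A i, (d k - x k)‖ ≤ δ / ((n + 1) * Λ) :=
        (norm_sum_le _ _).trans (hK' _ fun k hk => (le_max_right _ _).trans (hAK i k hk))
      refine (mul_le_of_le_one_left (by positivity) h2).trans ?_
      refine (mul_le_mul (hsΛ i) h3 (norm_nonneg _) hΛ0.le).trans_eq ?_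
      field_simp
    refine (norm_sum_le_of_le _ h1).trans ?_
    rw [Finset.sum_const, Finset.card_univ, Fintype.card_fin, nsmul_eq_mul, mul_div_assoc',
      div_le_iff₀ (by positivity)]
    nlinarith
  have hbound : ∀ a : Fin n → 𝕜, ‖a‖ = 1 →
      1 - δ ≤ ‖∑ i, a i • s (A i) • ∑ k ∈ A i, d k‖ ∧
      ‖∑ i, a i • s (A i) • ∑ k ∈ A i, d k‖ ≤ θ * (1 - δ) := by
    intro a ha
    have h1 := hpert a ha
    have h2 := norm_rpow_le_norm_sum hdisjA hunit a
    rw [ha, Real.one_rpow] at h2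
    have h3 := hK A hAm (fun i k hk => (le_max_left _ _).trans (hAK i k hk)) hAlt a
      fun i => (norm_le_pi_norm a i).trans ha.le
    rw [add_sub_cancel, ← norm_le_iff (by positivity), ← Real.rpow_mul (by positivity),
      div_mul_div_cancel₀ hr.ne', div_self hp.ne', Real.rpow_one] at h3
    have h4 := abs_le.1 ((abs_norm_sub_norm_le _ _).trans h1)
    rw [← hδθ]
    constructor <;> linarith [h4.1, h4.2]
  -- Rescaling by μ turns the bounds 1 - δ and θ(1 - δ) into 1 and θ; homogeneity then extends them
  -- from ‖a‖ = 1 to all a.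
  obtain ⟨μ, hμ⟩ := exists_norm_rpow_eq 𝕜 hr (show 0 ≤ (1 - δ)⁻¹ from
    inv_nonneg.2 (by linarith))
  refine ⟨A, fun i => μ * s (A i), hAlt, fun a => ?_⟩
  rcases eq_or_ne a 0 with rfl | ha
  · simp [Real.zero_rpow hr.ne']
  have ha0 : 0 < ‖a‖ := norm_pos_iff.2 ha
  obtain ⟨b, hb⟩ : ∃ b : Fin n → 𝕜, b = ((‖a‖⁻¹ : ℝ) : 𝕜) • a := ⟨_, rfl⟩
  have hb1 : ‖b‖ = 1 := by
    rw [hb, norm_smul, RCLike.norm_ofReal, abs_of_nonneg (by positivity), inv_mul_cancel₀ ha0.ne']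
  have hab : ∀ i, a i = ((‖a‖ : ℝ) : 𝕜) * b i := fun i => by
    rw [hb, Pi.smul_apply, smul_eq_mul, ← mul_assoc, ← RCLike.ofReal_mul,
      mul_inv_cancel₀ ha0.ne', RCLike.ofReal_one, one_mul]
  have hsum : ∑ i, a i • (μ * s (A i)) • ∑ k ∈ A i, d k
      = (((‖a‖ : ℝ) : 𝕜) * μ) • ∑ i, b i • s (A i) • ∑ k ∈ A i, d k := by
    rw [Finset.smul_sum]
    refine Finset.sum_congr rfl fun i _ => ?_
    rw [smul_smul, smul_smul, smul_smul, hab]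
    congr 1
    ring
  obtain ⟨h1, h2⟩ := hbound b hb1
  have h1δ : 0 < 1 - δ := by linarith
  rw [hsum, norm_smul_eq, norm_mul, RCLike.norm_ofReal, abs_of_nonneg ha0.le,
    Real.mul_rpow ha0.le (norm_nonneg _), hμ, Real.mul_rpow (by linarith) ha0.le, ← hθ, mul_assoc,
    mul_comm θ]
  have har : 0 ≤ ‖a‖ ^ min 1 p := by positivity
  constructor
  · refine le_mul_of_one_le_right har ?_
    rw [inv_mul_eq_div, le_div_iff₀ h1δ]
    linarith
  · refine mul_le_mul_of_nonneg_left ?_ har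
    rw [inv_mul_eq_div, div_le_iff₀ h1δ]
    exact h2

theorem isFiniteBlockSequence_sum_sub {X : Type*} [AddCommGroup X] [Module 𝕜 X] (y : ℕ → X)
    {σ : ℕ → ℕ} (hσ : StrictMono σ) {n : ℕ} {A : Fin n → Finset ℕ}
    (hA : ∀ i j, i < j → ∀ k ∈ A i, ∀ l ∈ A j, k < l) (s : Fin n → 𝕜)
    (hne : ∀ i, s i • ∑ k ∈ A i, (y (σ (2 * k)) - y (σ (2 * k + 1))) ≠ 0) :
    IsFiniteBlockSequence 𝕜 y
      fun i => s i • ∑ k ∈ A i, (y (σ (2 * k)) - y (σ (2 * k + 1))) := by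
  refine ⟨fun i => s i • ∑ k ∈ A i,
    (Finsupp.single (σ (2 * k)) 1 - Finsupp.single (σ (2 * k + 1)) 1), fun i => ?_, hne,
    fun i j hij k hk l hl => ?_⟩
  · simp [map_sum]
  · have hmem : ∀ i, ∀ k ∈ (s i • ∑ k ∈ A i, (Finsupp.single (σ (2 * k)) (1 : 𝕜)
        - Finsupp.single (σ (2 * k + 1)) 1)).support,
        ∃ κ ∈ A i, k = σ (2 * κ) ∨ k = σ (2 * κ + 1) := by
      intro i k hk
      rw [Finsupp.mem_support_iff, Finsupp.smul_apply, Finsupp.finsetSum_apply] at hk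
      obtain ⟨κ, hκ, hκk⟩ := Finset.exists_ne_zero_of_sum_ne_zero (right_ne_zero_of_smul hk)
      refine ⟨κ, hκ, ?_⟩
      by_contra! H
      refine hκk ?_
      rw [Finsupp.sub_apply, Finsupp.single_eq_of_ne H.1, Finsupp.single_eq_of_ne H.2, sub_zero]
    obtain ⟨κ, hκ, hκk⟩ := hmem i k hk
    obtain ⟨κ', hκ', hκl⟩ := hmem j l hl
    have h := hA i j hij κ hκ κ' hκ'
    rcases hκk with rfl | rfl <;> rcases hκl with rfl | rfl <;> exact hσ (by lia)

end GarlingF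

/-! ### The dichotomy -/

theorem mainTheorem7 {𝕜 : Type*} [RCLike 𝕜] (p : ℝ) (hp : 0 < p)
    (w : ℕ → ℝ) (hw : IsGarlingWeight w)
    (B : ℕ → garlingSpace 𝕜 w p hp)
    (hB : IsSubsymmetricBasicSequence 𝕜 B)
    (hne : ¬ EquivalentSequences 𝕜 B (lpUnitVectors 𝕜 p)) :
    LInftyBlockFinitelyRepresentable 𝕜 B := by
  have hr := GarlingF.min_one_pos hp
  let e := GarlingF.equiv 𝕜 hw hp
  have hnn : ∀ x : garlingSpace 𝕜 w p hp, 0 ≤ ‖x‖ := fun _ => ENNReal.toReal_nonneg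
  have he : ∀ x, ‖e x‖ = ‖x‖ ^ min 1 p := GarlingF.norm_equiv
  have hy := hB.equiv hr e hnn he
  obtain ⟨σ, x, t, hσ, ht, hx, hdx, c, C, hc, hxcC⟩ := GarlingF.exists_block_sequence hy
  by_cases hvan : ∀ ε > 0, ∃ J K, ∀ k ≥ K, ∀ S,
      shiftedSum w p J S (GarlingF.coords (x k)) ≤ ε
  · intro n ε hε
    obtain ⟨A, s, hA, hest⟩ := GarlingF.exists_almost_isometric ht.monotone hx hc
      (fun k => (hxcC k).1) (fun k => (hxcC k).2) hvan hdx n hε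
    set z : Fin n → garlingSpace 𝕜 w p hp :=
      fun i => s i • ∑ k ∈ A i, (B (σ (2 * k)) - B (σ (2 * k + 1)))
    have hz : ∀ a : Fin n → 𝕜, ‖a‖ ≤ ‖∑ i, a i • z i‖ ∧ ‖∑ i, a i • z i‖ ≤ (1 + ε) * ‖a‖ := by
      intro a
      have h1 : e (∑ i, a i • z i)
          = ∑ i, a i • s i • ∑ k ∈ A i, (e (B (σ (2 * k))) - e (B (σ (2 * k + 1)))) := by
        simp only [z, map_sum, map_smul, map_sub]
      have h2 := hest a
      rw [← h1, he, Real.rpow_le_rpow_iff (norm_nonneg _) (hnn _) hr,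
        Real.rpow_le_rpow_iff (hnn _) (by positivity) hr] at h2
      exact h2
    refine ⟨z, GarlingF.isFiniteBlockSequence_sum_sub B hσ hA s fun i hi => ?_, hz⟩
    -- The lower estimate at the i-th unit vector excludes a zero block.
    have h1 := (hz (Pi.single i 1)).1
    have h2 : ∑ j, (Pi.single i 1 : Fin n → 𝕜) j • z j = 0 := by
      refine Finset.sum_eq_zero fun j _ => ?_
      rcases eq_or_ne j i with rfl | hj
      · exact smul_eq_zero_of_right _ hi
      · rw [Pi.single_eq_of_ne hj, zero_smul]
    have h3 : ‖(0 : garlingSpace 𝕜 w p hp)‖ = 0 := by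
      have h4 := he 0
      rw [map_zero, norm_zero] at h4
      exact (Real.rpow_eq_zero (hnn 0) hr.ne').1 h4.symm
    rw [h2, h3] at h1
    have h5 := norm_le_pi_norm (Pi.single i 1 : Fin n → 𝕜) i
    rw [Pi.single_eq_same, norm_one] at h5
    linarith
  · push Not at hvan
    obtain ⟨c', hc', hS⟩ := hvan
    refine absurd (fun a => ?_) hne
    rw [← exists_seriesConvergesTo_equiv_iff hr e hnn he]
    exact GarlingF.equivalentSequences_lpUnitVectors hy hσ ht.monotone hx hdx
      (fun k => (hxcC k).2) hc' hS a
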